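/- Let $\epsilon>0$, $P\ge 1$, and let $$u_0(x)=\sum_{p=1}^P\Big(\frac{c_p}{x-z_p}+\frac{c_p^*}{x-z_p^*}\Big),$$ where $c_p\in\mathbb C\setminus\{0\}$, $\operatorname{Im} z_p>0$, $\operatorname{Re} z_1<\dots<\operatorname{Re} z_P$ and $\sum_{p}(c_p+c_p^*)=0$. With the principal logarithm put $$f(x)=\sum_{p=1}^P\Big[c_p\Big(\operatorname{Log}(i(x-z_p))+\tfrac{\pi i}2\Big)+c_p^*\Big(\operatorname{Log}(-i(x-z_p^*))-\tfrac{\pi i}2\Big)\Big],\qquad h(x;\lambda)=\lambda x+f(x),$$ and let $G$ be the plane cut along the vertical half-lines going up from each $z_p$ and down from each $z_p^*$. Contours: fix $a<\operatorname{Re}z_1$ and $b_m$ with $\operatorname{Re}z_m<b_m<\operatorname{Re}z_{m+1}$ for $m<P$, and $b_P>\operatorname{Re}z_P$. Let $U_m^<$ go from $a+i\infty$ vertically down to $a$, along the real axis to $b_m$, and vertically up to $b_m+i\infty$. Let $\ell_0(z_m)$ go from $a+i\infty$ vertically down to $a$, along the real axis to $\operatorname{Re}z_m$, and vertically up to $z_m$.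 Put $C_m^<=\ell_0(z_m)$ if $ic_m/\epsilon$ is a strictly negative integer, and $C_m^<=U_m^<$ otherwise. (By Cauchy's theorem the integrals below do not depend on the choice of $a$ and $b_m$, nor on the chosen contours with these ends in $G$.) For $\lambda<0$ define $$A^<_{mp}(\lambda)=\int_{C_m^<}\frac{e^{-ih(z;\lambda)/\epsilon}}{z-z_p}\,dz,\qquad D(\lambda)=\det \mathbf A^<(\lambda).$$ Suppose that $\lambda<0$, $D(\lambda)=0$, and that $\boldsymbol\phi=(\phi_1,\dots,\phi_P)^{\mathsf T}\in\mathbb C^P$ satisfies $\mathbf A^<(\lambda)\boldsymbol\phi=\mathbf 0$ and $\sum_p\phi_p=\lambda$. Define $$\Phi(x;\lambda)=-\frac i\epsilon e^{ih(x;\lambda)/\epsilon}\int_{-\infty}^x e^{-ih(z;\lambda)/\epsilon}\sum_{p=1}^P\frac{\phi_p}{z-z_p}\,dz,\qquad x\in G,$$ where the integral is an improper one, taken along the real axis from $-\infty$ to $\operatorname{Re}x$ and then vertically to $x$ in $G$. Then: 1. The improper integral converges, $u_0\,\Phi(\cdot;\lambda)\in L^1(\mathbb R)$, and $$\frac1{2\pi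 i}\int_{-\infty}^\infty u_0(x)\Phi(x;\lambda)\,dx=\lambda.$$ 2. $\Phi(\cdot;\lambda)\in\mathbb H^+(\mathbb R)$. More precisely, the restriction of $\Phi(\cdot;\lambda)$ to $\{x\in G:\operatorname{Im}x\ge0\}$ extends to a function $\Psi$ that is analytic on a neighbourhood of the closed upper half-plane and tends to $0$ as $|x|\to\infty$ uniformly for $\operatorname{Im}x\ge0$; moreover $\sup_{y>0}\|\Psi(\cdot+iy)\|_{L^2(\mathbb R)}<\infty$, $\Phi(\cdot;\lambda)|_{\mathbb R}\in L^2(\mathbb R)$, and $\Psi(\cdot+iy)\to\Phi(\cdot;\lambda)$ in $L^2(\mathbb R)$ as $y\downarrow0$. 3. Consequently $w=\Phi(\cdot;\lambda)|_{\mathbb R}$ is an eigenfunction with eigenvalue $\lambda$: it is a nonzero differentiable element of $\mathbb H^+(\mathbb R)$ and $$i\epsilon\frac{dw}{dx}+\lambda w=-\mathcal C^+[u_0w]\quad\text{on }\mathbb R,\qquad \mathcal C^+[\psi](x)=\lim_{\delta\downarrow0}\frac1{2\pi i}\int_{-\infty}^\infty\frac{\psi(y)}{y-(x+i\delta)}\,dy,$$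 where the limit exists for every real $x$. -/

import Mathlib

open MeasureTheory Filter Topology
open scoped ComplexConjugate NNReal ENNReal

noncomputable section

/-- The data of a real bounded rational potential with simple poles,
`u₀(x) = ∑ₚ cₚ / (x - zₚ) + c.c.`, with nonzero `cₚ`, poles `zₚ` in the open upper half-plane whose
real parts strictly increase with `p`, and `∑ₚ (cₚ + cₚ*) = 0` (so that `u₀` is integrable). -/
structure RationalPotential (P : ℕ) where
  c : Fin P → ℂ
  z : Fin P → ℂ
  c_ne_zero : ∀ p, c p ≠ 0
  im_pos : ∀ p, 0 < (z p).im
  re_strictMono : StrictMono fun p => (z p).re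
  sum_eq_zero : ∑ p, (c p + conj (c p)) = 0

namespace RationalPotential

variable {P : ℕ}

/-- The potential `u₀` on the real line (a real quantity, regarded as a complex number). -/
def u₀ (V : RationalPotential P) (x : ℝ) : ℂ :=
  ∑ p, (V.c p / ((x : ℂ) - V.z p) + conj (V.c p / ((x : ℂ) - V.z p)))

/-- The antiderivative `f` of the potential, for complex `x`: the abbreviation `+ c.c.` stands for
the Schwarz reflection `x ↦ conj (g (conj x))` of the first sum `g`. `Complex.log` is the principal
branch. -/
def f (V : RationalPotential P) (x : ℂ) : ℂ :=
  ∑ p, (V.c p * (Complex.log (Complex.I * (x - V.z p)) + Real.pi * Complex.I / 2)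
    + conj (V.c p) *
      (Complex.log (-Complex.I * (x - conj (V.z p))) - Real.pi * Complex.I / 2))

/-- The domain of analyticity of `f`: the plane without the vertical half-lines going up from each
`zₚ` and down from each `zₚ*`. -/
def G (V : RationalPotential P) : Set ℂ :=
  {x | ∀ p, x.re = (V.z p).re → |x.im| < (V.z p).im}

/-- `h(x; λ) = λ x + f(x)`. -/
def h (V : RationalPotential P) (lam : ℝ) (x : ℂ) : ℂ := lam * x + V.f x

/-- The function `exp(-i h(z; λ) / ε)`. -/
def expNeg (V : RationalPotential P) (ε lam : ℝ) (z : ℂ) : ℂ :=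
  Complex.exp (-Complex.I * V.h lam z / ε)

/-- Abscissae that single out one representative of each contour: `a` lies to the left of all poles,
and `b m` lies strictly between the abscissae of the poles number `m` and `m + 1` (to the right of
the last pole for the last `m`). -/
structure Abscissae (V : RationalPotential P) where
  a : ℝ
  b : Fin P → ℝ
  a_lt : ∀ p, a < (V.z p).re
  lt_b : ∀ m, (V.z m).re < b m
  b_lt : ∀ m q, m < q → b m < (V.z q).re

/-- Integral of `g` over the vertical half-line from `r` to `r + i∞`. -/
def verticalRay (g : ℂ → ℂ) (r : ℝ) : ℂ :=
  ∫ s in Set.Ioi (0 : ℝ), g (r + s * Complex.I) * Complex.I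

/-- Integral of `g` over the vertical segment from `r` to `r + i y`. -/
def verticalSegment (g : ℂ → ℂ) (r y : ℝ) : ℂ :=
  ∫ s in (0 : ℝ)..y, g (r + s * Complex.I) * Complex.I

/-- Integral over the contour `U_m^<`, from `i∞` to the left of all the branch cuts, to `i∞` between
the cuts of `z_m` and `z_{m+1}`: down from `a + i∞` to `a`, along the real axis to `b m`, up to
`b m + i∞`. This contour lies in `G`. -/
def integralU (V : RationalPotential P) (S : V.Abscissae) (m : Fin P) (g : ℂ → ℂ) : ℂ :=
  -verticalRay g S.a + (∫ t in S.a..S.b m, g t) + verticalRay g (S.b m)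

/-- Integral over the contour `ℓ₀(z_m)`, from `i∞` to the left of all the branch cuts, to `z_m`:
down from `a + i∞` to `a`, along the real axis to `Re z_m`, up to `z_m`. This contour lies in `G`
except for its end point. -/
def integralEll (V : RationalPotential P) (S : V.Abscissae) (m : Fin P) (g : ℂ → ℂ) : ℂ :=
  -verticalRay g S.a + (∫ t in S.a..(V.z m).re, g t) + verticalSegment g (V.z m).re (V.z m).im

/-- `i c_m / ε` is a strictly negative integer. -/
def IsExceptional (V : RationalPotential P) (ε : ℝ) (m : Fin P) : Prop :=
  ∃ n : ℕ, 0 < n ∧ Complex.I * V.c m / ε = -(n : ℂ)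

open Classical in
/-- Integral over the contour `C_m^<`: this is `ℓ₀(z_m)` in the exceptional case and `U_m^<`
otherwise. -/
def integralC (V : RationalPotential P) (ε : ℝ) (S : V.Abscissae) (m : Fin P) (g : ℂ → ℂ) : ℂ :=
  if V.IsExceptional ε m then V.integralEll S m g else V.integralU S m g

/-- The matrix `A^<(λ)`. -/
def matrixA (V : RationalPotential P) (ε : ℝ) (S : V.Abscissae) (lam : ℝ) :
    Matrix (Fin P) (Fin P) ℂ :=
  Matrix.of fun m p => V.integralC ε S m fun w => V.expNeg ε lam w / (w - V.z p)

/-- The Evans function `D(λ) = det A^<(λ)`. -/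
def evansD (V : RationalPotential P) (ε : ℝ) (S : V.Abscissae) (lam : ℝ) : ℂ :=
  (V.matrixA ε S lam).det

/-- The integrand `exp(-i h(z; λ) / ε) ∑ₚ φₚ / (z - zₚ)`. -/
def integrand (V : RationalPotential P) (ε lam : ℝ) (φ : Fin P → ℂ) (w : ℂ) : ℂ :=
  V.expNeg ε lam w * ∑ p, φ p / (w - V.z p)

/-- The function
`Φ(x; λ) = -(i / ε) exp(i h(x; λ) / ε) ∫_{-∞}^x exp(-i h(z; λ) / ε) ∑ₚ φₚ / (z - zₚ) dz`
for `x` in `G`. The integral is a conditionally convergent improper one, so it is a limit of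
integrals from `-R`; it is taken along the real axis up to `Re x` and then vertically to `x`, a
path that lies in `G` whenever `x` does. -/
def Phi (V : RationalPotential P) (ε lam : ℝ) (φ : Fin P → ℂ) (x : ℂ) : ℂ :=
  -(Complex.I / ε) * Complex.exp (Complex.I * V.h lam x / ε) *
    (limUnder atTop (fun R : ℝ => ∫ t in (-R)..x.re, V.integrand ε lam φ t)
      + verticalSegment (V.integrand ε lam φ) x.re x.im)

end RationalPotential

/-- `F` is holomorphic in the upper half-plane with uniformly bounded `L²` norms on horizontal
lines (the Hardy class `H²`), and `g ∈ L²(ℝ)` is its boundary value. -/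
def IsHardyExtension (F : ℂ → ℂ) (g : ℝ → ℂ) : Prop :=
  MemLp g 2 volume ∧
  DifferentiableOn ℂ F {x | 0 < x.im} ∧
  (∃ C : ℝ≥0, ∀ y : ℝ, 0 < y →
    eLpNorm (fun x : ℝ => F (x + y * Complex.I)) 2 volume ≤ (C : ℝ≥0∞)) ∧
  Tendsto (fun y : ℝ => eLpNorm (fun x : ℝ => F (x + y * Complex.I) - g x) 2 volume)
    (𝓝[>] 0) (𝓝 0)

/-- Membership in the Hardy subspace `ℍ⁺(ℝ)` of `L²(ℝ)`. -/
def MemHardyPlus (g : ℝ → ℂ) : Prop := ∃ F : ℂ → ℂ, IsHardyExtension F g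

/-- The Cauchy operator `C⁺`: `HasCauchyPlus ψ x l` says that `C⁺[ψ](x)` exists and equals `l`. -/
def HasCauchyPlus (ψ : ℝ → ℂ) (x : ℝ) (l : ℂ) : Prop :=
  (∀ δ : ℝ, 0 < δ → Integrable (fun y : ℝ => ψ y / (y - (x + δ * Complex.I)))) ∧
  Tendsto (fun δ : ℝ => 1 / (2 * Real.pi * Complex.I) *
    ∫ y : ℝ, ψ y / (y - (x + δ * Complex.I))) (𝓝[>] 0) (𝓝 l)

/-- `w` is a bound state eigenfunction with eigenvalue `λ`: a nontrivial element of `ℍ⁺(ℝ)` with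
`i ε w' + λ w = -C⁺[u w]` on the real line. -/
def IsBoundState (ε lam : ℝ) (u : ℝ → ℂ) (w : ℝ → ℂ) : Prop :=
  MemHardyPlus w ∧ w ≠ 0 ∧ Differentiable ℝ w ∧
  ∀ x : ℝ, ∃ l : ℂ, HasCauchyPlus (fun y => u y * w y) x l ∧
    Complex.I * ε * deriv w x + lam * w x = -l

end

/-! Differentiation gives `Φ' = (i/ε)((λ + u₀)Φ - q)` with `q = ∑ φ_p/(x - z_p)`. If `Φ` continues
to a function `Ψ` holomorphic on the closed upper half-plane and `O(1/x)` there, the rest is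
Cauchy's theorem. Put `K = -iεΨ' - λΨ`. Then `K` is holomorphic on the closed upper half-plane and
`u₀Φ = K + q` on the real line. Since all poles of `q` lie in the upper half-plane, `C⁺` reproduces
`K` and annihilates `q`, and `C⁺[u₀Φ] = K` is the eigenvalue equation. As `∑ φ_p = λ`, the function
`K` behaves like `-λ/x` at infinity; after `λ/(x + i)` is added to `K` and subtracted from `q`, the
first part integrates to zero and the second to `2πiλ`. The integral of `u₀Φ` is thus nonzero, and
so is `Φ`.

The continuation is built from `A φ = 0`. For `λ < 0` the integrand decays exponentially upwards, so
in each vertical strip between cuts one can integrate from `x` to `x + i∞`. For a non-exceptional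
`m`, row `m` says that the contour from `i∞` on the far left to `i∞` just right of the cut of `z_m`
contributes nothing; for an exceptional `m`, the integrand is single-valued around `z_m` and the ray
integrals do not jump there. Hence in every strip the integral from `-∞` to `x` is minus the ray
integral (`leftIntegral_eq_neg_rayIntegral`). Dividing the ray integral by the exponential makes the
choice of branch irrelevant, so all cuts may be turned downwards: `Phi_eq_rayQuotient` continues `Φ`
across the upward cuts and also gives the bound `O(1/x)`.

Only the points `z_m` remain. There the equation has a regular singular point with exponent `i
c_m/ε`, so either `Φ` extends or it has a pole of order `n` with `i c_m/ε = -n`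
(`analytic_or_pole_of_singular_ode`). In the second case row `m` is the integral over `ℓ₀(z_m)`; its
vanishing forces `exp(-ih/ε) Φ → 0` at `z_m`, whereas a pole of that order would give a nonzero
limit (`PhiUp_analytic`). -/

noncomputable section

/-! ### Integrals over vertical half-lines -/

/-- Integral of `g` over the vertical half-line from `x` to `x + i∞`. -/
def rayIntegral (g : ℂ → ℂ) (x : ℂ) : ℂ :=
  ∫ s in Set.Ioi (0 : ℝ), g (x + s * Complex.I) * Complex.I

/-- Above height `Y` the decay is given; below it, the translates of a ball form a compact set. The
constant is uniform in the base point, as domination under the integral sign and Cauchy's estimate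
require. -/
theorem exists_norm_le_exp_of_decay {g : ℂ → ℂ} {T : Set ℂ}
    (hup : ∀ x ∈ T, ∀ s : ℝ, 0 ≤ s → x + s * Complex.I ∈ T) (hg : ContinuousOn g T)
    {K κ Y : ℝ} (hκ : 0 < κ) (hb : ∀ z ∈ T, Y ≤ z.im → ‖g z‖ ≤ K * Real.exp (-κ * z.im))
    {x : ℂ} {r : ℝ} (hr : 0 < r) (hx : Metric.closedBall x r ⊆ T) :
    ∃ B : ℝ, ∀ y ∈ Metric.closedBall x r, ∀ s : ℝ, 0 ≤ s →
      ‖g (y + s * Complex.I)‖ ≤ B * Real.exp (-κ * s) := by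
  -- Base points have imaginary part at least `x.im - r`, so shifting any of them by `s ≥ S` reaches
  -- height `Y`.
  set S : ℝ := max 0 (Y - x.im + r) with hS
  have hcomp : IsCompact ((fun p : ℂ × ℝ => p.1 + p.2 * Complex.I) ''
      (Metric.closedBall x r ×ˢ Set.Icc 0 S)) :=
    ((isCompact_closedBall x r).prod isCompact_Icc).image (by fun_prop)
  have hsub : ((fun p : ℂ × ℝ => p.1 + p.2 * Complex.I) ''
      (Metric.closedBall x r ×ˢ Set.Icc 0 S)) ⊆ T := by
    rintro _ ⟨⟨y, s⟩, ⟨hy, hs⟩, rfl⟩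
    exact hup y (hx hy) s hs.1
  obtain ⟨M, hM⟩ := hcomp.exists_bound_of_continuousOn (hg.mono hsub)
  have hM0 : 0 ≤ M := (norm_nonneg _).trans
    (hM (x + (0 : ℝ) * Complex.I) ⟨(x, 0), ⟨Metric.mem_closedBall_self hr.le, le_rfl,
      le_max_left _ _⟩, rfl⟩)
  refine ⟨max (M * Real.exp (κ * S)) (|K| * Real.exp (κ * (|x.im| + r))), fun y hy s hs => ?_⟩
  have hyim : |y.im - x.im| ≤ r := by
    rw [Metric.mem_closedBall, dist_eq_norm] at hy
    exact (by simpa using Complex.abs_im_le_norm (y - x) : |y.im - x.im| ≤ ‖y - x‖).trans hy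
  rw [abs_le] at hyim
  rcases le_total s S with h | h
  · refine (hM _ ⟨(y, s), ⟨hy, hs, h⟩, rfl⟩).trans ?_
    calc M = M * (Real.exp (κ * s) * Real.exp (-κ * s)) := by
          rw [← Real.exp_add]; simp
      _ ≤ M * (Real.exp (κ * S) * Real.exp (-κ * s)) := by gcongr
      _ = M * Real.exp (κ * S) * Real.exp (-κ * s) := by ring
      _ ≤ _ := by gcongr; exact le_max_left _ _
  · have hY : Y ≤ (y + s * Complex.I).im := by
      have : Y - x.im + r ≤ S := le_max_right _ _
      simp; linarith
    refine (hb _ (hup y (hx hy) s hs) hY).trans ?_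
    have him : (y + s * Complex.I).im = y.im + s := by simp
    rw [him]
    calc K * Real.exp (-κ * (y.im + s)) ≤ |K| * Real.exp (-κ * (y.im + s)) := by
          gcongr; exact le_abs_self K
      _ ≤ |K| * Real.exp (κ * (|x.im| + r) + -κ * s) := by
          gcongr
          have := neg_abs_le x.im
          nlinarith
      _ = |K| * Real.exp (κ * (|x.im| + r)) * Real.exp (-κ * s) := by rw [Real.exp_add]; ring
      _ ≤ _ := by gcongr; exact le_max_right _ _

theorem integrableOn_exp_neg_mul {κ : ℝ} (hκ : 0 < κ) (B : ℝ) :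
    IntegrableOn (fun s : ℝ => B * Real.exp (-κ * s)) (Set.Ioi 0) :=
  (integrableOn_exp_mul_Ioi (by linarith) 0).const_mul B

/-- A holomorphic function on an upward closed open set which decays exponentially upwards has
the negative of its integral over vertical half-lines as an antiderivative. -/
theorem hasDerivAt_rayIntegral {g : ℂ → ℂ} {T : Set ℂ} (hT : IsOpen T)
    (hup : ∀ x ∈ T, ∀ s : ℝ, 0 ≤ s → x + s * Complex.I ∈ T) (hg : DifferentiableOn ℂ g T)
    {K κ Y : ℝ} (hκ : 0 < κ) (hb : ∀ z ∈ T, Y ≤ z.im → ‖g z‖ ≤ K * Real.exp (-κ * z.im))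
    {x : ℂ} (hx : x ∈ T) :
    IntegrableOn (fun s : ℝ => g (x + s * Complex.I)) (Set.Ioi 0) ∧
      HasDerivAt (rayIntegral g) (-g x) x := by
  obtain ⟨R, hR, hRT⟩ := Metric.isOpen_iff.1 hT x hx
  -- Base points vary within `r` and Cauchy's estimate uses circles of radius `r`, so a closed ball
  -- of radius `2 * r` must fit in `T`.
  set r := R / 4 with hr
  have hr0 : 0 < r := by positivity
  have hsub : Metric.closedBall x (2 * r) ⊆ T :=
    (Metric.closedBall_subset_ball (by rw [hr]; linarith)).trans hRT
  obtain ⟨B, hB⟩ := exists_norm_le_exp_of_decay hup hg.continuousOn hκ hb (by positivity) hsub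
  have hcont : ∀ y ∈ T, ContinuousOn (fun s : ℝ => g (y + s * Complex.I)) (Set.Ici 0) := by
    intro y hy
    refine hg.continuousOn.comp (by fun_prop) ?_
    intro s hs
    exact hup y hy s hs
  have hderc : ContinuousOn (deriv g) T := (hg.deriv hT).continuousOn
  have hcont' : ContinuousOn (fun s : ℝ => deriv g (x + s * Complex.I)) (Set.Ici 0) := by
    refine hderc.comp (by fun_prop) ?_
    intro s hs
    exact hup x hx s hs
  have hmeas : ∀ y ∈ T, AEStronglyMeasurable (fun s : ℝ => g (y + s * Complex.I))
      (volume.restrict (Set.Ioi 0)) := fun y hy =>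
    ((hcont y hy).mono Set.Ioi_subset_Ici_self).aestronglyMeasurable measurableSet_Ioi
  have hder : ∀ y ∈ Metric.ball x r, ∀ s : ℝ, 0 ≤ s →
      ‖deriv g (y + s * Complex.I)‖ ≤ B * Real.exp (-κ * s) / r := by
    intro y hy s hs
    have hmem : ∀ z ∈ Metric.closedBall (y + s * Complex.I) r,
        z - s * Complex.I ∈ Metric.closedBall x (2 * r) := by
      intro z hz
      rw [Metric.mem_closedBall, dist_eq_norm] at *
      rw [Metric.mem_ball, dist_eq_norm] at hy
      calc ‖z - s * Complex.I - x‖ = ‖(z - (y + s * Complex.I)) + (y - x)‖ := by congr 1; ring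
        _ ≤ _ := (norm_add_le _ _).trans (by linarith)
    have hT' : Metric.closedBall (y + s * Complex.I) r ⊆ T := by
      intro z hz
      have := hup _ (hsub (hmem z hz)) s hs
      simpa using this
    refine Complex.norm_deriv_le_of_forall_mem_sphere_norm_le hr0 ?_ ?_
    · refine DifferentiableOn.diffContOnCl ?_
      rw [closure_ball _ hr0.ne']
      exact hg.mono hT'
    · intro z hz
      have := hB _ (hmem z (Metric.sphere_subset_closedBall hz)) s hs
      simpa using this
  have hint : IntegrableOn (fun s : ℝ => g (x + s * Complex.I)) (Set.Ioi 0) := by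
    refine (integrableOn_exp_neg_mul hκ B).mono' (hmeas x hx) ?_
    refine (ae_restrict_mem measurableSet_Ioi).mono fun s hs => ?_
    exact hB x (Metric.mem_closedBall_self (by positivity)) s (le_of_lt hs)
  have hat : ∀ y ∈ Metric.ball x r, ∀ s : ℝ, 0 ≤ s → y + s * Complex.I ∈ T := fun y hy s hs =>
    hup y (hsub (Metric.closedBall_subset_closedBall (by linarith)
      (Metric.ball_subset_closedBall hy))) s hs
  have hda : ∀ z ∈ T, HasDerivAt g (deriv g z) z := fun z hz =>
    (hg.differentiableAt (hT.mem_nhds hz)).hasDerivAt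
  have key := hasDerivAt_integral_of_dominated_loc_of_deriv_le
    (μ := volume.restrict (Set.Ioi (0 : ℝ))) (F := fun y (s : ℝ) => g (y + s * Complex.I) * Complex.I)
    (F' := fun y (s : ℝ) => deriv g (y + s * Complex.I) * Complex.I)
    (bound := fun s => B / r * Real.exp (-κ * s)) (x₀ := x) (s := Metric.ball x r)
    (Metric.ball_mem_nhds x hr0) ?_ (hint.mul_const _) ?_ ?_ (integrableOn_exp_neg_mul hκ _) ?_
  · refine ⟨hint, ?_⟩
    have hlim : Tendsto (fun s : ℝ => g (x + s * Complex.I)) atTop (𝓝 0) := by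
      have h0 : Tendsto (fun s : ℝ => B * Real.exp (-κ * s)) atTop (𝓝 0) := by
        rw [← mul_zero B]
        refine (Real.tendsto_exp_atBot.comp ?_).const_mul B
        exact tendsto_id.const_mul_atTop_of_neg (by linarith)
      refine squeeze_zero_norm' ?_ h0
      filter_upwards [eventually_ge_atTop 0] with s hs
      exact hB x (Metric.mem_closedBall_self (by positivity)) s hs
    -- The differentiated integrand `g'(x + is) i` is the derivative in `s` of `g(x + is)`, so its
    -- integral is `0 - g x`.
    have hv := integral_Ioi_of_hasDerivAt_of_tendsto' (a := (0 : ℝ))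
      (f := fun s : ℝ => g (x + s * Complex.I))
      (f' := fun s : ℝ => deriv g (x + s * Complex.I) * Complex.I) (m := 0) ?_ key.1 hlim
    · have := key.2
      rw [hv] at this
      simpa [rayIntegral] using! this
    · intro s hs
      have h1 : HasDerivAt (fun s : ℝ => x + s * Complex.I) Complex.I s := by
        simpa using ((Complex.ofRealCLM.hasDerivAt (x := s)).mul_const Complex.I).const_add x
      exact HasDerivAt.comp_of_eq s (hda _ (hup x hx s hs)) h1 rfl
  · filter_upwards [Metric.ball_mem_nhds x hr0] with y hy
    refine (hmeas y ?_).mul_const _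
    simpa using hat y hy 0 le_rfl
  · refine AEStronglyMeasurable.mul_const ?_ _
    exact (hcont'.mono Set.Ioi_subset_Ici_self).aestronglyMeasurable measurableSet_Ioi
  · refine (ae_restrict_mem measurableSet_Ioi).mono fun s hs y hy => ?_
    have := hder y hy s (le_of_lt hs)
    simp only [norm_mul, Complex.norm_I, mul_one]
    calc _ ≤ _ := this
      _ = _ := by ring
  · refine (ae_restrict_mem measurableSet_Ioi).mono fun s hs y hy => ?_
    have h1 : HasDerivAt (fun y : ℂ => y + s * Complex.I) 1 y := (hasDerivAt_id y).add_const _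
    have := (HasDerivAt.comp_of_eq y (hda _ (hat y hy s (le_of_lt hs))) h1 rfl).mul_const Complex.I
    simpa using! this

/-- Bound for the integral over a vertical half-line of an exponentially decaying function. -/
theorem norm_rayIntegral_le {g : ℂ → ℂ} {x : ℂ} {B κ : ℝ} (hκ : 0 < κ)
    (hb : ∀ s : ℝ, 0 ≤ s → ‖g (x + s * Complex.I)‖ ≤ B * Real.exp (-κ * s)) :
    ‖rayIntegral g x‖ ≤ B / κ := by
  have h : ∫ s in Set.Ioi (0 : ℝ), B * Real.exp (-κ * s) = B / κ := by
    rw [integral_const_mul, integral_exp_mul_Ioi (by linarith)]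
    simp; field_simp
  rw [← h]
  refine norm_integral_le_of_norm_le (integrableOn_exp_neg_mul hκ B) ?_
  refine (ae_restrict_mem measurableSet_Ioi).mono fun s hs => ?_
  simpa using hb s (le_of_lt hs)

/-! ### Regular singular points of first-order linear equations -/

/-- Isolated singularities of solutions of `(x - ζ) y' = A y + B` with continuous `A` and `B`: such
a solution extends holomorphically to `ζ`, or it has a pole of order `-A ζ`. -/
theorem analytic_or_pole_of_singular_ode {y A B : ℂ → ℂ} {ζ : ℂ} {r : ℝ} (hr : 0 < r)
    (hA : ContinuousOn A (Metric.ball ζ r)) (hB : ContinuousOn B (Metric.ball ζ r))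
    (hy : ∀ x ∈ Metric.ball ζ r, x ≠ ζ → HasDerivAt y ((A x * y x + B x) / (x - ζ)) x) :
    (∃ k : ℂ → ℂ, AnalyticAt ℂ k ζ ∧ y =ᶠ[𝓝[≠] ζ] k) ∨
    ∃ n : ℕ, 0 < n ∧ A ζ = -n ∧ ∃ k : ℂ → ℂ, AnalyticAt ℂ k ζ ∧ k ζ ≠ 0 ∧
      ∀ᶠ x in 𝓝[≠] ζ, (x - ζ) ^ n * y x = k x := by
  set ρ := r / 2 with hρ
  have hρ0 : 0 < ρ := by positivity
  have hsub : Metric.closedBall ζ ρ ⊆ Metric.ball ζ r :=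
    Metric.closedBall_subset_ball (by rw [hρ]; linarith)
  obtain ⟨M₁, hM₁⟩ := (isCompact_closedBall ζ ρ).exists_bound_of_continuousOn (hA.mono hsub)
  obtain ⟨M₂, hM₂⟩ := (isCompact_closedBall ζ ρ).exists_bound_of_continuousOn (hB.mono hsub)
  obtain ⟨D, hD⟩ := (isCompact_sphere ζ ρ).exists_bound_of_continuousOn (f := y) (by
    intro x hx
    refine (hy x (hsub (Metric.sphere_subset_closedBall hx)) ?_).continuousAt.continuousWithinAt
    rintro rfl
    simp [hρ0.ne] at hx)
  -- `M` bounds both coefficients and is the Gronwall rate; it is an integer so that `(x - ζ) ^ M`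
  -- is a polynomial, and positive so that the Gronwall bound has its exponential form.
  obtain ⟨M, hM⟩ := exists_nat_ge (max 1 (max M₁ M₂))
  simp only [max_le_iff] at hM
  have hMpos : (0 : ℝ) < M := by linarith [hM.1]
  have hgrow : ∀ x ∈ Metric.closedBall ζ ρ, x ≠ ζ →
      ‖y x‖ ≤ (D + 1) * (ρ / ‖x - ζ‖) ^ M := by
    intro x hx hxz
    have hu : 0 < ‖x - ζ‖ := norm_pos_iff.2 (sub_ne_zero.2 hxz)
    have hule : ‖x - ζ‖ ≤ ρ := by simpa [dist_eq_norm] using hx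
    -- Radial path `ζ + w e^{-t}` from the circle of radius `ρ` to `x`, reached at `t₁ = log (ρ / ‖x
    -- - ζ‖)`. In the variable `t` the equation is `dy/dt = -(A y + B)`, with no singularity, and
    -- Gronwall's `e^{M t₁}` is a power of `ρ / ‖x - ζ‖`.
    set w : ℂ := (ρ / ‖x - ζ‖ : ℝ) * (x - ζ) with hw
    have hwn : ‖w‖ = ρ := by
      rw [hw, norm_mul, Complex.norm_real, Real.norm_of_nonneg (by positivity)]
      field_simp
    have hw0 : w ≠ 0 := by rw [← norm_pos_iff, hwn]; exact hρ0
    set t₁ := Real.log (ρ / ‖x - ζ‖) with ht₁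
    have ht₁0 : 0 ≤ t₁ := Real.log_nonneg (by rw [le_div_iff₀ hu]; linarith)
    have hexp : Real.exp t₁ = ρ / ‖x - ζ‖ := Real.exp_log (by positivity)
    have hp : ∀ t : ℝ, HasDerivAt (fun t : ℝ => ζ + w * (Real.exp (-t) : ℂ))
        (-(w * (Real.exp (-t) : ℂ))) t := by
      intro t
      have h1 : HasDerivAt (fun t : ℝ => Real.exp (-t)) (-Real.exp (-t)) t := by
        simpa using (hasDerivAt_neg t).exp
      simpa using (h1.ofReal_comp.const_mul w).const_add ζ
    have hin : ∀ t : ℝ, 0 ≤ t → ζ + w * (Real.exp (-t) : ℂ) ∈ Metric.closedBall ζ ρ := by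
      intro t ht
      rw [Metric.mem_closedBall, dist_eq_norm, add_sub_cancel_left, norm_mul, hwn,
        Complex.norm_real, Real.norm_of_nonneg (Real.exp_pos _).le]
      have : Real.exp (-t) ≤ 1 := Real.exp_le_one_iff.2 (by linarith)
      nlinarith
    have hne : ∀ t : ℝ, w * (Real.exp (-t) : ℂ) ≠ 0 := fun t =>
      mul_ne_zero hw0 (Complex.ofReal_ne_zero.2 (Real.exp_pos _).ne')
    have hf : ∀ t : ℝ, 0 ≤ t → HasDerivAt (fun t : ℝ => y (ζ + w * (Real.exp (-t) : ℂ)))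
        (-(A (ζ + w * (Real.exp (-t) : ℂ)) * y (ζ + w * (Real.exp (-t) : ℂ))
          + B (ζ + w * (Real.exp (-t) : ℂ)))) t := by
      intro t ht
      have h1 := hy _ (hsub (hin t ht)) (by simpa using hne t)
      refine (HasDerivAt.comp_of_eq t h1 (hp t) rfl).congr_deriv ?_
      have := hne t
      rw [add_sub_cancel_left]
      field_simp
    have hG := norm_le_gronwallBound_of_norm_deriv_right_le
      (f := fun t : ℝ => y (ζ + w * (Real.exp (-t) : ℂ))) (δ := D) (K := M) (ε := M) (a := 0)
      (b := t₁) (fun t ht => (hf t ht.1).continuousAt.continuousWithinAt)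
      (fun t ht => (hf t ht.1).hasDerivWithinAt) ?_ ?_ t₁ ⟨ht₁0, le_rfl⟩
    · have hx' : ζ + w * (Real.exp (-t₁) : ℂ) = x := by
        rw [Real.exp_neg, hexp, hw]
        have h1 : (‖x - ζ‖ : ℂ) ≠ 0 := Complex.ofReal_ne_zero.2 hu.ne'
        have h2 : (ρ : ℂ) ≠ 0 := Complex.ofReal_ne_zero.2 hρ0.ne'
        push_cast
        field_simp
        ring
      simp only [hx'] at hG
      refine hG.trans ?_
      rw [gronwallBound_of_K_ne_0 hMpos.ne', sub_zero]
      simp only [Real.exp_nat_mul, hexp, div_self hMpos.ne']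
      linarith
    · refine hD _ ?_
      simp [hwn]
    · intro t ht
      rw [norm_neg]
      refine (norm_add_le _ _).trans (add_le_add ?_ ?_)
      · rw [norm_mul]
        gcongr
        exact (hM₁ _ (hin t ht.1)).trans hM.2.1
      · exact (hM₂ _ (hin t ht.1)).trans hM.2.2
  -- Polynomial growth makes `H₀` bounded, so its singularity is removable and `y` is meromorphic at
  -- `ζ`.
  set H₀ : ℂ → ℂ := fun x => (x - ζ) ^ M * y x with hH₀
  have hH : DifferentiableOn ℂ (Function.update H₀ ζ (limUnder (𝓝[≠] ζ) H₀))
      (Metric.ball ζ ρ) := by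
    refine Complex.differentiableOn_update_limUnder_of_bddAbove (Metric.ball_mem_nhds ζ hρ0) ?_ ?_
    · intro x hx
      have h1 := hy x (hsub (Metric.ball_subset_closedBall hx.1)) hx.2
      exact ((by fun_prop : DifferentiableAt ℂ (fun x : ℂ => (x - ζ) ^ M) x).mul
        h1.differentiableAt).differentiableWithinAt
    · refine ⟨(D + 1) * ρ ^ M, ?_⟩
      rintro _ ⟨x, ⟨hx, hxz⟩, rfl⟩
      have hu : 0 < ‖x - ζ‖ := norm_pos_iff.2 (sub_ne_zero.2 hxz)
      have := hgrow x (Metric.ball_subset_closedBall hx) hxz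
      simp only [Function.comp, hH₀, norm_mul, norm_pow]
      calc ‖x - ζ‖ ^ M * ‖y x‖ ≤ ‖x - ζ‖ ^ M * ((D + 1) * (ρ / ‖x - ζ‖) ^ M) := by gcongr
        _ = (D + 1) * ρ ^ M := by rw [div_pow]; field_simp
  have hHan : AnalyticAt ℂ (Function.update H₀ ζ (limUnder (𝓝[≠] ζ) H₀)) ζ :=
    hH.analyticAt (Metric.ball_mem_nhds ζ hρ0)
  have hmer : MeromorphicAt y ζ := by
    have h1 : MeromorphicAt (fun x => ((x - ζ) ^ M)⁻¹ *
        Function.update H₀ ζ (limUnder (𝓝[≠] ζ) H₀) x) ζ :=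
      ((by fun_prop : AnalyticAt ℂ (fun x : ℂ => (x - ζ) ^ M) ζ).meromorphicAt.inv).mul
        hHan.meromorphicAt
    refine h1.congr ?_
    filter_upwards [self_mem_nhdsWithin] with x hx
    have hx' : x - ζ ≠ 0 := sub_ne_zero.2 hx
    rw [Function.update_of_ne hx]
    simp only [hH₀]
    field_simp
  by_cases htop : meromorphicOrderAt y ζ = ⊤
  · exact Or.inl ⟨0, analyticAt_const, meromorphicOrderAt_eq_top_iff.1 htop⟩
  · obtain ⟨n, hn⟩ := WithTop.ne_top_iff_exists.1 htop
    obtain ⟨k, hk, hk0, hky⟩ := (meromorphicOrderAt_eq_int_iff hmer).1 hn.symm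
    simp only [smul_eq_mul] at hky
    rcases le_or_gt 0 n with hn0 | hn0
    · left
      lift n to ℕ using hn0
      refine ⟨fun x => (x - ζ) ^ n * k x, by fun_prop, ?_⟩
      filter_upwards [hky] with x hx
      rw [hx, zpow_natCast]
    · right
      obtain ⟨N, rfl⟩ : ∃ N : ℕ, n = -N := ⟨n.natAbs, by omega⟩
      have hN : 0 < N := by omega
      have hky' : ∀ᶠ x in 𝓝[≠] ζ, (x - ζ) ^ N * y x = k x := by
        filter_upwards [hky, self_mem_nhdsWithin] with x hx hxz
        have hx' : x - ζ ≠ 0 := sub_ne_zero.2 hxz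
        rw [hx, zpow_neg, zpow_natCast]
        field_simp
      refine ⟨N, hN, ?_, k, hk, hk0, hky'⟩
      -- The equation rewritten for `k = (x - ζ)^N y`. Its limit at `ζ` is `0 = (N + A ζ) k ζ`,
      -- which fixes the order of the pole.
      have hev : ∀ᶠ x in 𝓝[≠] ζ,
          (x - ζ) * deriv k x = (N + A x) * k x + (x - ζ) ^ N * B x := by
        have hball : ∀ᶠ x in 𝓝[≠] ζ, x ∈ Metric.ball ζ r :=
          mem_nhdsWithin_of_mem_nhds (Metric.ball_mem_nhds ζ hr)
        have hev2 : ∀ᶠ x in 𝓝[≠] ζ, ∀ᶠ z in 𝓝 x, (z - ζ) ^ N * y z = k z := by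
          have := eventually_eventually_nhdsWithin.2 hky'
          filter_upwards [this, self_mem_nhdsWithin] with x hx hxz
          rwa [nhdsWithin_eq_nhds.2 (isOpen_compl_singleton.mem_nhds hxz)] at hx
        filter_upwards [hball, hev2, self_mem_nhdsWithin] with x hxb hx hxz
        have hx' : x - ζ ≠ 0 := sub_ne_zero.2 hxz
        have h1 := ((((hasDerivAt_id x).sub_const ζ).pow N).mul (hy x hxb hxz))
        have h2 : HasDerivAt k _ x := h1.congr_of_eventuallyEq
          (by filter_upwards [hx] with z hz; exact hz.symm)
        rw [h2.deriv, ← hx.self_of_nhds]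
        simp only [id, Pi.pow_apply]
        obtain ⟨N', rfl⟩ : ∃ N', N = N' + 1 := ⟨N - 1, by omega⟩
        simp only [Nat.add_sub_cancel]
        field_simp
        push_cast
        ring
      have hζ : ζ ∈ Metric.ball ζ r := Metric.mem_ball_self hr
      have hAc : ContinuousAt A ζ := hA.continuousAt (Metric.ball_mem_nhds ζ hr)
      have hBc : ContinuousAt B ζ := hB.continuousAt (Metric.ball_mem_nhds ζ hr)
      have hkc := hk.continuousAt
      have hdk : ContinuousAt (deriv k) ζ := hk.deriv.continuousAt
      have hl : ContinuousAt (fun x => (x - ζ) * deriv k x) ζ := by fun_prop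
      have hrr : ContinuousAt (fun x => (N + A x) * k x + (x - ζ) ^ N * B x) ζ := by fun_prop
      have heq := tendsto_nhds_unique (hl.tendsto.mono_left nhdsWithin_le_nhds)
        ((hrr.tendsto.mono_left nhdsWithin_le_nhds).congr' (by
          filter_upwards [hev] with x hx; exact hx.symm))
      simp only [sub_self, zero_mul, ne_eq, hN.ne', not_false_eq_true, zero_pow, add_zero] at heq
      have := (mul_eq_zero.1 heq.symm).resolve_right hk0
      linear_combination this

/-! ### Cauchy's theorem and formula on the closed upper half-plane -/

theorem integrable_of_continuous_of_norm_le_div_sq {f : ℝ → ℂ} (hf : Continuous f) {C R : ℝ}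
    (hb : ∀ x : ℝ, R ≤ |x| → ‖f x‖ ≤ C / x ^ 2) : Integrable f := by
  set R' := max R 1
  obtain ⟨M, hM⟩ := (isCompact_Icc (a := -R') (b := R')).exists_bound_of_continuousOn hf.continuousOn
  have hR1 : 1 ≤ R' := le_max_right _ _
  have hM0 : 0 ≤ M := (norm_nonneg _).trans (hM 0 ⟨by linarith, by linarith⟩)
  refine (integrable_inv_one_add_sq.const_mul (M * (1 + R' ^ 2) + 2 * |C|)).mono'
    hf.aestronglyMeasurable (Eventually.of_forall fun x => ?_)
  have hpos : 0 < 1 + x ^ 2 := by positivity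
  rw [← div_eq_mul_inv, le_div_iff₀ hpos]
  rcases le_total |x| R' with h | h
  · have h1 := hM x (abs_le.1 h)
    have h2 : x ^ 2 ≤ R' ^ 2 := by rw [← sq_abs x]; gcongr
    calc ‖f x‖ * (1 + x ^ 2) ≤ M * (1 + R' ^ 2) := by gcongr
      _ ≤ _ := by linarith [abs_nonneg C]
  · have h1 := hb x ((le_max_left _ _).trans h)
    have hx : 1 ≤ x ^ 2 := by
      rw [← sq_abs x]; exact one_le_pow₀ (hR1.trans h)
    calc ‖f x‖ * (1 + x ^ 2) ≤ (|C| / x ^ 2) * (1 + x ^ 2) := by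
          gcongr
          refine h1.trans ?_
          gcongr
          exact le_abs_self C
      _ ≤ 2 * |C| := by
          rw [div_mul_eq_mul_div, div_le_iff₀ (by linarith)]
          nlinarith [abs_nonneg C]
      _ ≤ _ := by
          have : 0 ≤ M * (1 + R' ^ 2) := by positivity
          linarith

/-- The integral over the real line of a function that is holomorphic in the upper half-plane,
continuous up to the real line, and decays quadratically, vanishes. -/
theorem integral_eq_zero_of_upperHalfPlane {F : ℂ → ℂ} (hc : ContinuousOn F {z | 0 ≤ z.im})
    (hd : DifferentiableOn ℂ F {z | 0 < z.im}) {C R : ℝ}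
    (hb : ∀ z : ℂ, 0 ≤ z.im → R ≤ ‖z‖ → ‖F z‖ ≤ C / ‖z‖ ^ 2) :
    Integrable (fun x : ℝ => F x) ∧ ∫ x : ℝ, F x = 0 := by
  have hcont : Continuous fun x : ℝ => F x := by
    refine hc.comp_continuous Complex.continuous_ofReal (fun x => by simp)
  have hint : Integrable (fun x : ℝ => F x) := by
    refine integrable_of_continuous_of_norm_le_div_sq hcont (C := C) (R := R) fun x hx => ?_
    simpa using hb x (by simp) (by simpa using hx)
  refine ⟨hint, ?_⟩
  have h1 : Tendsto (fun r : ℝ => ∫ x in (-r)..r, F x) atTop (𝓝 (∫ x : ℝ, F x)) :=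
    intervalIntegral_tendsto_integral hint tendsto_neg_atTop_atBot tendsto_id
  refine tendsto_nhds_unique h1 ?_
  have h2 : Tendsto (fun r : ℝ => 4 * |C| / r) atTop (𝓝 0) :=
    tendsto_const_nhds.div_atTop tendsto_id
  refine squeeze_zero_norm' ?_ h2
  filter_upwards [eventually_ge_atTop (max R 1)] with r hr
  have hrR : R ≤ r := (le_max_left _ _).trans hr
  have hr1 : 1 ≤ r := (le_max_right _ _).trans hr
  have hr0 : 0 < r := by linarith
  -- Boundary of `[-r, r] × [0, r]`: the three sides off the real axis have total length `4r` and
  -- the integrand is at most `|C| / r²` on them.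
  have hrect := Complex.integral_boundary_rect_eq_zero_of_continuousOn_of_differentiableOn F
    (-r : ℂ) (r + r * Complex.I) ?_ ?_
  · simp only [Complex.neg_re, Complex.ofReal_re, Complex.add_re, Complex.mul_re, Complex.I_re,
      mul_zero, Complex.ofReal_im, Complex.I_im, mul_one, sub_self, add_zero, Complex.neg_im,
      neg_zero, Complex.ofReal_zero, zero_mul, Complex.add_im, Complex.mul_im, zero_add,
      smul_eq_mul, Complex.ofReal_neg] at hrect
    have hside : ∀ (w : ℝ → ℂ) (a b : ℝ), (∀ t ∈ Set.uIoc a b, 0 ≤ (w t).im ∧ r ≤ ‖w t‖) →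
        ‖∫ t in a..b, F (w t)‖ ≤ |C| / r ^ 2 * |b - a| := by
      intro w a b hw
      refine intervalIntegral.norm_integral_le_of_norm_le_const fun t ht => ?_
      obtain ⟨h3, h4⟩ := hw t ht
      refine (hb _ h3 (hrR.trans h4)).trans ?_
      calc C / ‖w t‖ ^ 2 ≤ |C| / ‖w t‖ ^ 2 := by gcongr; exact le_abs_self C
        _ ≤ _ := by gcongr
    have htop := hside (fun t : ℝ => t + r * Complex.I) (-r) r (fun t _ => by
      refine ⟨by simpa using hr0.le, ?_⟩
      have := Complex.abs_im_le_norm (t + r * Complex.I)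
      simp only [Complex.add_im, Complex.ofReal_im, Complex.mul_im, Complex.ofReal_re,
        Complex.I_im, mul_one, Complex.I_re, mul_zero, add_zero, zero_add] at this
      exact (le_abs_self r).trans this)
    have hright := hside (fun t : ℝ => r + t * Complex.I) 0 r (fun t ht => by
      rw [Set.uIoc_of_le hr0.le] at ht
      refine ⟨by simpa using ht.1.le, ?_⟩
      have := Complex.abs_re_le_norm (r + t * Complex.I)
      simp only [Complex.add_re, Complex.ofReal_re, Complex.mul_re, Complex.ofReal_im,
        Complex.I_im, mul_one, Complex.I_re, mul_zero, add_zero, sub_zero] at this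
      exact (le_abs_self r).trans this)
    have hleft := hside (fun t : ℝ => -r + t * Complex.I) 0 r (fun t ht => by
      rw [Set.uIoc_of_le hr0.le] at ht
      refine ⟨by simpa using ht.1.le, ?_⟩
      have := Complex.abs_re_le_norm (-r + t * Complex.I)
      simp only [Complex.add_re, Complex.neg_re, Complex.ofReal_re, Complex.mul_re,
        Complex.ofReal_im, Complex.I_im, mul_one, Complex.I_re, mul_zero, add_zero, sub_zero,
        abs_neg] at this
      exact (le_abs_self r).trans this)
    rw [show |r - -r| = 2 * r by rw [abs_of_pos (by linarith)]; ring] at htop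
    rw [sub_zero, abs_of_pos hr0] at hright hleft
    have heq : ∫ x in (-r)..r, F x = (∫ t in (-r)..r, F (t + r * Complex.I)) -
        Complex.I * (∫ t in (0 : ℝ)..r, F (r + t * Complex.I)) +
        Complex.I * ∫ t in (0 : ℝ)..r, F (-r + t * Complex.I) := by
      linear_combination hrect
    rw [heq]
    refine (norm_add_le _ _).trans ((add_le_add (norm_sub_le _ _) le_rfl).trans ?_)
    rw [norm_mul, norm_mul, Complex.norm_I, one_mul, one_mul]
    have : 4 * |C| / r = |C| / r ^ 2 * (2 * r) + |C| / r ^ 2 * r + |C| / r ^ 2 * r := by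
      field_simp; ring
    linarith
  · refine hc.mono fun z hz => ?_
    have := hz.2
    simp [Set.uIcc_of_le hr0.le] at this
    exact this.1
  · refine hd.mono fun z hz => ?_
    have := hz.2
    simp [hr0.le] at this
    exact this.1

theorem norm_half_le_norm_sub {z w : ℂ} (h : 2 * ‖w‖ ≤ ‖z‖) : ‖z‖ / 2 ≤ ‖z - w‖ := by
  have := norm_sub_norm_le z w
  linarith

/-- The Cauchy kernel of two points in the upper half-plane. -/
theorem integral_inv_mul_inv_eq_zero {z w : ℂ} (hz : 0 < z.im) (hw : 0 < w.im) :
    Integrable (fun y : ℝ => ((y : ℂ) - z)⁻¹ * ((y : ℂ) - w)⁻¹) ∧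
      ∫ y : ℝ, ((y : ℂ) - z)⁻¹ * ((y : ℂ) - w)⁻¹ = 0 := by
  have hne : ∀ u x : ℂ, 0 < u.im → 0 ≤ x.im → -x - u ≠ 0 := by
    intro u x hu hx h
    have := congrArg Complex.im h
    simp at this
    linarith
  have hd : ∀ x : ℂ, 0 ≤ x.im →
      DifferentiableAt ℂ (fun x : ℂ => (-x - z)⁻¹ * (-x - w)⁻¹) x := fun x hx =>
    ((by fun_prop : DifferentiableAt ℂ (fun x : ℂ => -x - z) x).inv (hne z x hz hx)).mul
      ((by fun_prop : DifferentiableAt ℂ (fun x : ℂ => -x - w) x).inv (hne w x hw hx))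
  -- The reflection `y ↦ -y` moves both poles to the lower half-plane.
  have key := integral_eq_zero_of_upperHalfPlane (F := fun x => (-x - z)⁻¹ * (-x - w)⁻¹)
    (C := 4) (R := 2 * ‖z‖ + 2 * ‖w‖ + 1)
    (fun x hx => (hd x hx).continuousAt.continuousWithinAt)
    (fun x hx => (hd x (le_of_lt hx)).differentiableWithinAt) (by
      intro x hx hR
      have h1 : ‖x‖ / 2 ≤ ‖-x - z‖ := by
        have := norm_half_le_norm_sub (z := -x) (w := z) (by
          rw [norm_neg]; linarith [norm_nonneg w])
        rwa [norm_neg] at this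
      have h2 : ‖x‖ / 2 ≤ ‖-x - w‖ := by
        have := norm_half_le_norm_sub (z := -x) (w := w) (by
          rw [norm_neg]; linarith [norm_nonneg z])
        rwa [norm_neg] at this
      have hx0 : 0 < ‖x‖ := by linarith [norm_nonneg z, norm_nonneg w]
      rw [norm_mul, norm_inv, norm_inv]
      calc ‖-x - z‖⁻¹ * ‖-x - w‖⁻¹ ≤ (‖x‖ / 2)⁻¹ * (‖x‖ / 2)⁻¹ := by gcongr
        _ = 4 / ‖x‖ ^ 2 := by field_simp; norm_num)
  constructor
  · have := key.1.comp_neg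
    simpa using this
  · have := integral_neg_eq_self (fun y : ℝ => ((y : ℂ) - z)⁻¹ * ((y : ℂ) - w)⁻¹) volume
    rw [← this]
    simpa using key.2

/-- The Cauchy kernel of a point in the upper half-plane and `-i`. -/
theorem integral_inv_sub_inv_eq {z : ℂ} (hz : 0 < z.im) :
    Integrable (fun y : ℝ => ((y : ℂ) - z)⁻¹ - ((y : ℂ) + Complex.I)⁻¹) ∧
      ∫ y : ℝ, ((y : ℂ) - z)⁻¹ - ((y : ℂ) + Complex.I)⁻¹ = 2 * Real.pi * Complex.I := by
  have h1 := integral_inv_mul_inv_eq_zero hz (w := Complex.I) (by simp)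
  -- Inserting `1/(y - i)` leaves a product of two upper kernels, of integral zero, and `2i/(1 +
  -- y²)`, of integral `2πi`.
  have h2 : (fun y : ℝ => ((y : ℂ) - z)⁻¹ - ((y : ℂ) + Complex.I)⁻¹) =
      fun y : ℝ => (z - Complex.I) * (((y : ℂ) - z)⁻¹ * ((y : ℂ) - Complex.I)⁻¹) +
        2 * Complex.I * ((((1 + y ^ 2)⁻¹ : ℝ)) : ℂ) := by
    funext y
    have a1 : (y : ℂ) - z ≠ 0 := fun h => by
      have := congrArg Complex.im h; simp at this; linarith
    have a2 : (y : ℂ) - Complex.I ≠ 0 := fun h => by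
      have := congrArg Complex.im h; simp at this
    have a3 : (y : ℂ) + Complex.I ≠ 0 := fun h => by
      have := congrArg Complex.im h; simp at this
    have a4 : (1 + (y : ℂ) ^ 2) = (y - Complex.I) * (y + Complex.I) := by
      linear_combination Complex.I_sq
    push_cast
    rw [a4]
    field_simp
    ring
  have hi : Integrable (fun y : ℝ => ((((1 + y ^ 2)⁻¹ : ℝ)) : ℂ)) :=
    integrable_inv_one_add_sq.ofReal
  rw [h2]
  refine ⟨(h1.1.const_mul _).add (hi.const_mul _), ?_⟩
  rw [integral_add (h1.1.const_mul _) (hi.const_mul _), integral_const_mul, integral_const_mul,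
    h1.2, integral_complex_ofReal, integral_univ_inv_one_add_sq]
  ring

/-- Cauchy's formula for functions on the closed upper half-plane. -/
theorem integral_div_sub_of_upperHalfPlane {K : ℂ → ℂ} (hK : AnalyticOnNhd ℂ K {z | 0 ≤ z.im})
    {C R : ℝ} (hb : ∀ z : ℂ, 0 ≤ z.im → R ≤ ‖z‖ → ‖K z‖ ≤ C / ‖z‖) {ζ : ℂ} (hζ : 0 < ζ.im) :
    Integrable (fun y : ℝ => K y * ((y : ℂ) - ζ)⁻¹) ∧
      ∫ y : ℝ, K y * ((y : ℂ) - ζ)⁻¹ = 2 * Real.pi * Complex.I * K ζ := by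
  have hI : ∀ z : ℂ, 0 ≤ z.im → z + Complex.I ≠ 0 := by
    intro z hz h
    have := congrArg Complex.im h
    simp at this; linarith
  -- Subtracting a multiple of `1/(z + i)` makes the function vanish at `ζ` and keeps it `O(1/z)`;
  -- its divided slope at `ζ` is then holomorphic and `O(1/z²)`, and only an explicit kernel is left
  -- to integrate.
  set N : ℂ → ℂ := fun z => K z - K ζ * (ζ + Complex.I) * (z + Complex.I)⁻¹ with hN
  have hNd : ∀ z : ℂ, 0 ≤ z.im → DifferentiableAt ℂ N z := fun z hz =>
    (hK z hz).differentiableAt.sub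
      (((by fun_prop : DifferentiableAt ℂ (fun z : ℂ => z + Complex.I) z).inv
        (hI z hz)).const_mul _)
  have hN0 : N ζ = 0 := by
    simp only [hN]
    rw [mul_assoc, mul_inv_cancel₀ (hI ζ hζ.le), mul_one, sub_self]
  have hopen : IsOpen {z : ℂ | 0 < z.im} := isOpen_lt continuous_const Complex.continuous_im
  have hcl : {z : ℂ | 0 ≤ z.im} ∈ 𝓝 ζ :=
    mem_of_superset (hopen.mem_nhds hζ) fun z (hz : 0 < z.im) => hz.le
  have hslope : ∀ z : ℂ, z ≠ ζ → dslope N ζ z = N z * (z - ζ)⁻¹ := by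
    intro z hz
    rw [dslope_of_ne _ hz, slope_def_field, hN0, sub_zero, div_eq_mul_inv]
  have key := integral_eq_zero_of_upperHalfPlane (F := dslope N ζ)
    (C := 2 * (|C| + 2 * ‖K ζ * (ζ + Complex.I)‖)) (R := max R (2 * ‖ζ‖ + 2))
    ((continuousOn_dslope hcl).2 ⟨fun z hz => (hNd z hz).continuousAt.continuousWithinAt,
      hNd ζ hζ.le⟩)
    ((Complex.differentiableOn_dslope (hopen.mem_nhds hζ)).2 fun z hz =>
      (hNd z (le_of_lt hz)).differentiableWithinAt) (by
      intro z hz hR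
      simp only [max_le_iff] at hR
      have hz0 : 0 < ‖z‖ := by linarith [norm_nonneg ζ]
      have hzζ : z ≠ ζ := by
        rintro rfl
        linarith [norm_nonneg z]
      have h1 : ‖z‖ / 2 ≤ ‖z - ζ‖ := norm_half_le_norm_sub (by linarith)
      have h2 : ‖z‖ / 2 ≤ ‖z + Complex.I‖ := by
        have := norm_half_le_norm_sub (z := z) (w := -Complex.I) (by
          simp; linarith [norm_nonneg ζ])
        simpa using this
      rw [hslope z hzζ, norm_mul, norm_inv]
      have h3 : ‖N z‖ ≤ (|C| + 2 * ‖K ζ * (ζ + Complex.I)‖) / ‖z‖ := by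
        simp only [hN]
        refine (norm_sub_le _ _).trans ?_
        rw [norm_mul _ (z + Complex.I)⁻¹, norm_inv, add_div]
        refine add_le_add ((hb z hz hR.1).trans ?_) ?_
        · gcongr; exact le_abs_self C
        · calc _ ≤ ‖K ζ * (ζ + Complex.I)‖ * (‖z‖ / 2)⁻¹ := by gcongr
            _ = _ := by field_simp
      calc ‖N z‖ * ‖z - ζ‖⁻¹
          ≤ (|C| + 2 * ‖K ζ * (ζ + Complex.I)‖) / ‖z‖ * (‖z‖ / 2)⁻¹ := by gcongr
        _ = _ := by field_simp)
  have hb2 := integral_inv_sub_inv_eq hζ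
  have heq : (fun y : ℝ => K y * ((y : ℂ) - ζ)⁻¹) = fun y : ℝ => dslope N ζ y +
      K ζ * (((y : ℂ) - ζ)⁻¹ - ((y : ℂ) + Complex.I)⁻¹) := by
    funext y
    have hy : (y : ℂ) ≠ ζ := by rintro rfl; simp at hζ
    have a1 := sub_ne_zero.2 hy
    have a3 := hI y (by simp)
    rw [hslope _ hy]
    simp only [hN]
    field_simp
    ring
  rw [heq]
  refine ⟨key.1.add (hb2.1.const_mul _), ?_⟩
  rw [integral_add key.1 (hb2.1.const_mul _), key.2, integral_const_mul, hb2.2]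
  ring

/-! ### A criterion for the Hardy class -/

/-- A function holomorphic on the closed upper half-plane and `O(1/z)` belongs to the Hardy
class. -/
theorem isHardyExtension_of_norm_le {F : ℂ → ℂ} (hF : AnalyticOnNhd ℂ F {z | 0 ≤ z.im}) {C : ℝ}
    (hb : ∀ z : ℂ, 0 ≤ z.im → ‖F z‖ ^ 2 ≤ C * (1 + z.re ^ 2)⁻¹) :
    IsHardyExtension F (fun x : ℝ => F x) := by
  have hline : ∀ y : ℝ, 0 ≤ y → Continuous fun x : ℝ => F (x + y * Complex.I) := fun y hy =>
    hF.continuousOn.comp_continuous (by fun_prop) (fun x => by simpa using hy)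
  have hint : ∀ A : ℝ, Integrable fun x : ℝ => A * (1 + x ^ 2)⁻¹ := fun A =>
    integrable_inv_one_add_sq.const_mul A
  have hsq : ∀ f : ℝ → ℂ, eLpNorm f 2 volume = (∫⁻ x, ENNReal.ofReal (‖f x‖ ^ 2)) ^ (1 / 2 : ℝ) := by
    intro f
    rw [eLpNorm_eq_lintegral_rpow_enorm_toReal (by simp) (by simp)]
    congr 1
    refine lintegral_congr fun x => ?_
    rw [ENNReal.ofReal_pow (norm_nonneg _), ofReal_norm]
    simp
  have hfin : ∀ A : ℝ, ∫⁻ x : ℝ, ENNReal.ofReal (A * (1 + x ^ 2)⁻¹) ≠ ∞ := fun A =>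
    (hint A).lintegral_lt_top.ne
  have hcont0 : Continuous fun x : ℝ => F x := by simpa using hline 0 le_rfl
  have hbound : ∀ y : ℝ, 0 ≤ y → ∀ x : ℝ, ‖F (x + y * Complex.I)‖ ^ 2 ≤ C * (1 + x ^ 2)⁻¹ := by
    intro y hy x
    simpa using hb (x + y * Complex.I) (by simpa using hy)
  refine ⟨?_, fun z (hz : 0 < z.im) => (hF z hz.le).differentiableAt.differentiableWithinAt, ?_, ?_⟩
  · rw [memLp_two_iff_integrable_sq_norm hcont0.aestronglyMeasurable]
    refine (hint C).mono' (hcont0.norm.pow 2).aestronglyMeasurable (Eventually.of_forall fun x => ?_)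
    simpa using hbound 0 le_rfl x
  · refine ⟨((∫⁻ x : ℝ, ENNReal.ofReal (C * (1 + x ^ 2)⁻¹)) ^ (1 / 2 : ℝ)).toNNReal, fun y hy => ?_⟩
    rw [ENNReal.coe_toNNReal (ENNReal.rpow_ne_top_of_nonneg (by norm_num) (hfin C)), hsq]
    gcongr with x
    exact hbound y hy.le x
  · simp only [hsq]
    have h0 : (0 : ℝ≥0∞) = (∫⁻ _ : ℝ, 0) ^ (1 / 2 : ℝ) := by simp
    rw [h0]
    refine (ENNReal.continuous_rpow_const.tendsto _).comp ?_
    refine tendsto_lintegral_filter_of_dominated_convergence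
      (fun x => ENNReal.ofReal (4 * C * (1 + x ^ 2)⁻¹)) ?_ ?_ (hfin _) ?_
    · filter_upwards [self_mem_nhdsWithin] with y hy
      exact ENNReal.measurable_ofReal.comp
        (((hline y (le_of_lt hy)).sub hcont0).norm.pow 2).measurable
    · filter_upwards [self_mem_nhdsWithin] with y hy
      refine Eventually.of_forall fun x => ENNReal.ofReal_le_ofReal ?_
      have h1 := hbound y (le_of_lt hy) x
      have h2 := hbound 0 le_rfl x
      simp only [Complex.ofReal_zero, zero_mul, add_zero] at h2
      have h3 := norm_sub_le (F (x + y * Complex.I)) (F x)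
      calc ‖F (x + y * Complex.I) - F x‖ ^ 2
          ≤ (‖F (x + y * Complex.I)‖ + ‖F x‖) ^ 2 := by gcongr
        _ ≤ 2 * (‖F (x + y * Complex.I)‖ ^ 2 + ‖F x‖ ^ 2) := add_sq_le
        _ ≤ _ := by linarith
    · refine Eventually.of_forall fun x => ?_
      have h1 : ContinuousAt (fun y : ℝ => F (x + y * Complex.I)) 0 := by
        have : ContinuousAt F (x + (0 : ℝ) * Complex.I) := (hF _ (by simp)).continuousAt
        exact ContinuousAt.comp (f := fun y : ℝ => (x + y * Complex.I : ℂ)) this (by fun_prop)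
      have h2 : ContinuousAt (fun y : ℝ => ENNReal.ofReal (‖F (x + y * Complex.I) - F x‖ ^ 2)) 0 := by
        exact ENNReal.continuous_ofReal.continuousAt.comp ((h1.sub continuousAt_const).norm.pow 2)
      have h3 := h2.tendsto.mono_left (nhdsWithin_le_nhds (s := Set.Ioi 0))
      simpa using h3

/-! ### Logarithm estimates -/

theorem abs_log_sub_log_le {a b : ℝ} (ha : 1 ≤ a) (hb : 1 ≤ b) :
    |Real.log a - Real.log b| ≤ |a - b| := by
  have key : ∀ {a b : ℝ}, 1 ≤ a → 1 ≤ b → Real.log a - Real.log b ≤ |a - b| := by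
    intro a b ha hb
    rw [← Real.log_div (by linarith) (by linarith)]
    refine (Real.log_le_sub_one_of_pos (by positivity)).trans ?_
    rw [div_sub_one (by linarith), div_le_iff₀ (by linarith)]
    nlinarith [le_abs_self (a - b), abs_nonneg (a - b)]
  rw [abs_le]
  exact ⟨by have := key hb ha; rw [abs_sub_comm] at this; linarith, key ha hb⟩

/-- With conjugate coefficients the moduli enter only through `c.im * (log ‖w‖ - log ‖w'‖)`, so the
logarithmic growth cancels; the arguments are bounded by `π` each. -/
theorem abs_im_mul_log_add_conj_le (c : ℂ) {w w' : ℂ} (hw : 1 ≤ ‖w‖) (hw' : 1 ≤ ‖w'‖) {D : ℝ}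
    (hD : |‖w‖ - ‖w'‖| ≤ D) :
    |(c * Complex.log w + conj c * Complex.log w').im| ≤ ‖c‖ * (2 * Real.pi + D) := by
  have h1 : (c * Complex.log w + conj c * Complex.log w').im =
      c.re * (w.arg + w'.arg) + c.im * (Real.log ‖w‖ - Real.log ‖w'‖) := by
    simp [Complex.log_re, Complex.log_im]; ring
  rw [h1]
  refine (abs_add_le _ _).trans ?_
  rw [abs_mul, abs_mul, mul_add]
  have h2 : |w.arg + w'.arg| ≤ 2 * Real.pi :=
    (abs_add_le _ _).trans (by linarith [Complex.abs_arg_le_pi w, Complex.abs_arg_le_pi w'])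
  gcongr
  · exact Complex.abs_re_le_norm c
  · exact Complex.abs_im_le_norm c
  · exact (abs_log_sub_log_le hw hw').trans hD

/-! ### The potential, its antiderivatives and their domains -/

namespace RationalPotential

variable {P : ℕ} (V : RationalPotential P)

/-- The potential as a rational function of a complex variable. -/
def u₀Ext (x : ℂ) : ℂ := ∑ p, (V.c p / (x - V.z p) + conj (V.c p) / (x - conj (V.z p)))

/-- The rational function `∑ₚ φₚ / (x - zₚ)`. -/
def poleSum (φ : Fin P → ℂ) (x : ℂ) : ℂ := ∑ p, φ p / (x - V.z p)

/-- An antiderivative of the potential with all branch cuts pointing downwards. -/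
def fUp (x : ℂ) : ℂ :=
  ∑ p, (V.c p * Complex.log (-Complex.I * (x - V.z p)) +
    conj (V.c p) * Complex.log (-Complex.I * (x - conj (V.z p))))

/-- The analogue of `expNeg` with all branch cuts pointing downwards. -/
def expNegUp (ε lam : ℝ) (x : ℂ) : ℂ := Complex.exp (-Complex.I * (lam * x + V.fUp x) / ε)

/-- The plane without the vertical lines through the poles. -/
def offLines : Set ℂ := {x | ∀ p, x.re ≠ (V.z p).re}

/-- The plane without the vertical half-lines going down from each `zₚ`. -/
def upDomain : Set ℂ := {x | ∀ p, x.re = (V.z p).re → (V.z p).im < x.im}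

theorem isOpen_offLines : IsOpen V.offLines := by
  have : V.offLines = ⋂ p, {x : ℂ | x.re ≠ (V.z p).re} := by ext; simp [offLines]
  rw [this]
  exact isOpen_iInter_of_finite fun p => isOpen_ne_fun Complex.continuous_re continuous_const

theorem isOpen_upDomain : IsOpen V.upDomain := by
  have : V.upDomain = ⋂ p, ({x : ℂ | x.re ≠ (V.z p).re} ∪ {x : ℂ | (V.z p).im < x.im}) := by
    ext; simp [upDomain, imp_iff_not_or]
  rw [this]
  exact isOpen_iInter_of_finite fun p =>
    (isOpen_ne_fun Complex.continuous_re continuous_const).union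
      (isOpen_lt continuous_const Complex.continuous_im)

theorem isOpen_G : IsOpen V.G := by
  have : V.G = ⋂ p, ({x : ℂ | x.re ≠ (V.z p).re} ∪ {x : ℂ | |x.im| < (V.z p).im}) := by
    ext; simp [G, imp_iff_not_or]
  rw [this]
  exact isOpen_iInter_of_finite fun p =>
    (isOpen_ne_fun Complex.continuous_re continuous_const).union
      (isOpen_lt Complex.continuous_im.abs continuous_const)

theorem offLines_subset_G : V.offLines ⊆ V.G := fun _ hx p hp => absurd hp (hx p)

theorem offLines_subset_upDomain : V.offLines ⊆ V.upDomain := fun _ hx p hp => absurd hp (hx p)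

theorem ofReal_mem_G (x : ℝ) : (x : ℂ) ∈ V.G := fun p _ => by simpa using V.im_pos p

/-- On the line through a pole, `G` stays below the pole and `upDomain` above it. Two formulas for
the continuation of `Phi` therefore need to be compared only inside the open strips. -/
theorem G_inter_upDomain_subset : V.G ∩ V.upDomain ⊆ V.offLines := by
  rintro x ⟨hG, hU⟩ p hp
  linarith [hG p hp, hU p hp, le_abs_self x.im]

theorem add_mul_I_mem_offLines {x : ℂ} (hx : x ∈ V.offLines) (s : ℝ) :
    x + s * Complex.I ∈ V.offLines := fun p => by simpa using hx p

theorem add_mul_I_mem_upDomain {x : ℂ} (hx : x ∈ V.upDomain) {s : ℝ} (hs : 0 ≤ s) :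
    x + s * Complex.I ∈ V.upDomain := fun p hp => by
  have := hx p (by simpa using hp)
  simp; linarith

theorem sub_z_ne_zero_of_mem_G {x : ℂ} (hx : x ∈ V.G) (p : Fin P) : x - V.z p ≠ 0 := by
  intro h
  rw [sub_eq_zero] at h
  have := hx p (by rw [h])
  rw [h] at this
  exact absurd this (not_lt.2 (le_abs_self _))

theorem sub_z_ne_zero_of_mem_upDomain {x : ℂ} (hx : x ∈ V.upDomain) (p : Fin P) :
    x - V.z p ≠ 0 := by
  intro h
  rw [sub_eq_zero] at h
  have := hx p (by rw [h])
  rw [h] at this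
  exact absurd this (lt_irrefl _)

theorem hasDerivAt_log_const_mul_sub {a z x : ℂ} (ha : a ≠ 0)
    (h : a * (x - z) ∈ Complex.slitPlane) :
    HasDerivAt (fun x => Complex.log (a * (x - z))) (x - z)⁻¹ x := by
  have h1 : HasDerivAt (fun x : ℂ => a * (x - z)) a x := by
    simpa using ((hasDerivAt_id x).sub_const z).const_mul a
  have h2 : x - z ≠ 0 := by
    intro h0
    rw [h0, mul_zero] at h
    exact Complex.zero_notMem_slitPlane h
  refine (h1.clog h).congr_deriv ?_
  field_simp

theorem I_mul_sub_mem_slitPlane {x z : ℂ} (h : x.re = z.re → x.im < z.im) :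
    Complex.I * (x - z) ∈ Complex.slitPlane := by
  rw [Complex.mem_slitPlane_iff]
  by_cases hre : x.re = z.re
  · left; simpa using h hre
  · right; simpa [sub_eq_zero] using hre

theorem neg_I_mul_sub_mem_slitPlane {x z : ℂ} (h : x.re = z.re → z.im < x.im) :
    -Complex.I * (x - z) ∈ Complex.slitPlane := by
  rw [Complex.mem_slitPlane_iff]
  by_cases hre : x.re = z.re
  · left; simpa using h hre
  · right
    simp
    intro h0
    exact hre (by linarith)

theorem hasDerivAt_f {x : ℂ} (hx : x ∈ V.G) : HasDerivAt V.f (V.u₀Ext x) x := by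
  have := HasDerivAt.fun_sum (u := Finset.univ) (x := x) (A := fun p (x : ℂ) =>
    V.c p * (Complex.log (Complex.I * (x - V.z p)) + Real.pi * Complex.I / 2)
    + conj (V.c p) *
      (Complex.log (-Complex.I * (x - conj (V.z p))) - Real.pi * Complex.I / 2))
    (A' := fun p => V.c p / (x - V.z p) + conj (V.c p) / (x - conj (V.z p))) (by
      intro p _
      have h1 := hasDerivAt_log_const_mul_sub Complex.I_ne_zero
        (I_mul_sub_mem_slitPlane (x := x) (z := V.z p) fun h => (abs_lt.1 (hx p h)).2)
      have h2 := hasDerivAt_log_const_mul_sub (neg_ne_zero.2 Complex.I_ne_zero)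
        (neg_I_mul_sub_mem_slitPlane (x := x) (z := conj (V.z p)) fun h => by
          have := (abs_lt.1 (hx p (by simpa using h))).1
          simpa using this)
      exact ((h1.add_const _).const_mul _).add ((h2.sub_const _).const_mul _))
  exact this

theorem hasDerivAt_fUp {x : ℂ} (hx : x ∈ V.upDomain) : HasDerivAt V.fUp (V.u₀Ext x) x := by
  have := HasDerivAt.fun_sum (u := Finset.univ) (x := x) (A := fun p (x : ℂ) =>
    V.c p * Complex.log (-Complex.I * (x - V.z p)) +
    conj (V.c p) * Complex.log (-Complex.I * (x - conj (V.z p))))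
    (A' := fun p => V.c p / (x - V.z p) + conj (V.c p) / (x - conj (V.z p))) (by
      intro p _
      have h1 := hasDerivAt_log_const_mul_sub (neg_ne_zero.2 Complex.I_ne_zero)
        (neg_I_mul_sub_mem_slitPlane (x := x) (z := V.z p) fun h => hx p h)
      have h2 := hasDerivAt_log_const_mul_sub (neg_ne_zero.2 Complex.I_ne_zero)
        (neg_I_mul_sub_mem_slitPlane (x := x) (z := conj (V.z p)) fun h => by
          have := hx p (by simpa using h)
          have := V.im_pos p
          simp; linarith)
      exact (h1.const_mul _).add (h2.const_mul _))
  exact this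

theorem hasDerivAt_exp_phase {F : ℂ → ℂ} {F' x : ℂ} (ε lam : ℝ) (hF : HasDerivAt F F' x) :
    HasDerivAt (fun x => Complex.exp (-Complex.I * (lam * x + F x) / ε))
      (-(Complex.I / ε) * (lam + F') * Complex.exp (-Complex.I * (lam * x + F x) / ε)) x := by
  have h1 : HasDerivAt (fun x : ℂ => -Complex.I * (lam * x + F x) / ε)
      (-Complex.I * (lam * 1 + F') / ε) x :=
    ((((hasDerivAt_id x).const_mul (lam : ℂ)).add hF).const_mul _).div_const _
  refine h1.cexp.congr_deriv ?_
  ring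

theorem hasDerivAt_expNeg (ε lam : ℝ) {x : ℂ} (hx : x ∈ V.G) :
    HasDerivAt (V.expNeg ε lam) (-(Complex.I / ε) * (lam + V.u₀Ext x) * V.expNeg ε lam x) x :=
  hasDerivAt_exp_phase ε lam (V.hasDerivAt_f hx)

theorem hasDerivAt_expNegUp (ε lam : ℝ) {x : ℂ} (hx : x ∈ V.upDomain) :
    HasDerivAt (V.expNegUp ε lam)
      (-(Complex.I / ε) * (lam + V.u₀Ext x) * V.expNegUp ε lam x) x :=
  hasDerivAt_exp_phase ε lam (V.hasDerivAt_fUp hx)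

theorem expNeg_ne_zero (ε lam : ℝ) (x : ℂ) : V.expNeg ε lam x ≠ 0 := Complex.exp_ne_zero _

theorem expNegUp_ne_zero (ε lam : ℝ) (x : ℂ) : V.expNegUp ε lam x ≠ 0 := Complex.exp_ne_zero _

theorem differentiableAt_poleSum (φ : Fin P → ℂ) {x : ℂ} (hx : ∀ p, x - V.z p ≠ 0) :
    DifferentiableAt ℂ (V.poleSum φ) x := by
  unfold poleSum
  refine DifferentiableAt.fun_sum fun p _ => ?_
  exact (differentiableAt_const _).div (by fun_prop) (hx p)

/-! ### Estimates far from the poles -/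

/-- A radius beyond which all poles are far away. -/
def farRadius : ℝ := 1 + 2 * ∑ p, ‖V.z p‖

theorem one_le_farRadius : 1 ≤ V.farRadius := by
  have : 0 ≤ ∑ p, ‖V.z p‖ := Finset.sum_nonneg fun p _ => norm_nonneg _
  unfold farRadius; linarith

theorem norm_z_le_farRadius (p : Fin P) : 1 + 2 * ‖V.z p‖ ≤ V.farRadius := by
  have : ‖V.z p‖ ≤ ∑ p, ‖V.z p‖ :=
    Finset.single_le_sum (f := fun p => ‖V.z p‖) (fun p _ => norm_nonneg _) (Finset.mem_univ p)
  unfold farRadius; linarith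

theorem far_sub {x : ℂ} (hx : V.farRadius ≤ ‖x‖) (p : Fin P) :
    1 ≤ ‖x - V.z p‖ ∧ ‖x‖ / 2 ≤ ‖x - V.z p‖ := by
  have h1 := V.norm_z_le_farRadius p
  have h2 := norm_sub_norm_le x (V.z p)
  have h3 := norm_nonneg (V.z p)
  constructor <;> linarith

theorem far_sub_conj {x : ℂ} (hx : V.farRadius ≤ ‖x‖) (p : Fin P) :
    1 ≤ ‖x - conj (V.z p)‖ ∧ ‖x‖ / 2 ≤ ‖x - conj (V.z p)‖ := by
  have h1 := V.norm_z_le_farRadius p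
  have h2 := norm_sub_norm_le x (conj (V.z p))
  have h3 := norm_nonneg (V.z p)
  rw [RCLike.norm_conj] at h2
  constructor <;> linarith

theorem abs_norm_sub_z_sub_norm_sub_conj_z_le {x : ℂ} (p : Fin P) :
    |‖x - V.z p‖ - ‖x - conj (V.z p)‖| ≤ 2 * ‖V.z p‖ := by
  refine (abs_norm_sub_norm_le _ _).trans ?_
  rw [sub_sub_sub_cancel_left]
  refine (norm_sub_le _ _).trans ?_
  rw [RCLike.norm_conj]; linarith

theorem exists_abs_im_f_le : ∃ C : ℝ, ∀ x : ℂ, V.farRadius ≤ ‖x‖ → |(V.f x).im| ≤ C := by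
  refine ⟨∑ p, (‖V.c p‖ * (2 * Real.pi + 2 * ‖V.z p‖) +
    |(V.c p * (Real.pi * Complex.I / 2) - conj (V.c p) * (Real.pi * Complex.I / 2)).im|),
    fun x hx => ?_⟩
  simp only [f, Complex.im_sum]
  refine (Finset.abs_sum_le_sum_abs _ _).trans (Finset.sum_le_sum fun p _ => ?_)
  have h := abs_im_mul_log_add_conj_le (V.c p) (w := Complex.I * (x - V.z p))
    (w' := -Complex.I * (x - conj (V.z p))) (by simpa using (V.far_sub hx p).1)
    (by simpa using (V.far_sub_conj hx p).1) (D := 2 * ‖V.z p‖)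
    (by simpa using V.abs_norm_sub_z_sub_norm_sub_conj_z_le p)
  rw [show ∀ a b k : ℂ, V.c p * (a + k) + conj (V.c p) * (b - k) =
    (V.c p * a + conj (V.c p) * b) + (V.c p * k - conj (V.c p) * k) by intros; ring,
    Complex.add_im]
  exact (abs_add_le _ _).trans (by gcongr)

theorem exists_abs_im_fUp_le : ∃ C : ℝ, ∀ x : ℂ, V.farRadius ≤ ‖x‖ → |(V.fUp x).im| ≤ C := by
  refine ⟨∑ p, ‖V.c p‖ * (2 * Real.pi + 2 * ‖V.z p‖), fun x hx => ?_⟩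
  simp only [fUp, Complex.im_sum]
  refine (Finset.abs_sum_le_sum_abs _ _).trans (Finset.sum_le_sum fun p _ => ?_)
  exact abs_im_mul_log_add_conj_le (V.c p) (w := -Complex.I * (x - V.z p))
    (w' := -Complex.I * (x - conj (V.z p))) (by simpa using (V.far_sub hx p).1)
    (by simpa using (V.far_sub_conj hx p).1) (D := 2 * ‖V.z p‖)
    (by simpa using V.abs_norm_sub_z_sub_norm_sub_conj_z_le p)

theorem norm_exp_phase (ε lam : ℝ) (x w : ℂ) :
    ‖Complex.exp (-Complex.I * (lam * x + w) / ε)‖ = Real.exp ((lam * x.im + w.im) / ε) := by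
  rw [Complex.norm_exp, Complex.div_ofReal_re]
  simp

theorem exists_norm_expNeg_le {ε : ℝ} (hε : 0 < ε) (lam : ℝ) :
    ∃ C : ℝ, 0 < C ∧ ∀ x : ℂ, V.farRadius ≤ ‖x‖ →
      ‖V.expNeg ε lam x‖ ≤ C * Real.exp (-(-lam / ε) * x.im) := by
  obtain ⟨C, hC⟩ := V.exists_abs_im_f_le
  refine ⟨Real.exp (C / ε), Real.exp_pos _, fun x hx => ?_⟩
  rw [expNeg, h, norm_exp_phase, ← Real.exp_add]
  gcongr
  have := (abs_le.1 (hC x hx)).2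
  have h1 : (V.f x).im / ε ≤ C / ε := by gcongr
  calc _ = lam * x.im / ε + (V.f x).im / ε := by ring
    _ ≤ lam * x.im / ε + C / ε := by gcongr
    _ = _ := by ring

/-- The bound on the inverse serves the division in `rayQuotient`: the two exponentials cancel
there. -/
theorem exists_norm_expNegUp_le {ε : ℝ} (hε : 0 < ε) (lam : ℝ) :
    ∃ C : ℝ, 0 < C ∧ ∀ x : ℂ, V.farRadius ≤ ‖x‖ →
      ‖V.expNegUp ε lam x‖ ≤ C * Real.exp (-(-lam / ε) * x.im) ∧
      ‖V.expNegUp ε lam x‖⁻¹ ≤ C * Real.exp ((-lam / ε) * x.im) := by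
  obtain ⟨C, hC⟩ := V.exists_abs_im_fUp_le
  refine ⟨Real.exp (C / ε), Real.exp_pos _, fun x hx => ?_⟩
  rw [expNegUp, norm_exp_phase, ← Real.exp_neg, ← Real.exp_add, ← Real.exp_add]
  obtain ⟨h1, h2⟩ := abs_le.1 (hC x hx)
  have h1' : -(V.fUp x).im / ε ≤ C / ε := by gcongr; linarith
  have h2' : (V.fUp x).im / ε ≤ C / ε := by gcongr
  constructor <;> gcongr
  · calc _ = lam * x.im / ε + (V.fUp x).im / ε := by ring
      _ ≤ lam * x.im / ε + C / ε := by gcongr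
      _ = _ := by ring
  · calc _ = -lam * x.im / ε + -(V.fUp x).im / ε := by ring
      _ ≤ -lam * x.im / ε + C / ε := by gcongr
      _ = _ := by ring

theorem norm_poleSum_le (φ : Fin P → ℂ) {x : ℂ} (hx : V.farRadius ≤ ‖x‖) :
    ‖V.poleSum φ x‖ ≤ 2 * (∑ p, ‖φ p‖) / ‖x‖ := by
  have hx0 : 0 < ‖x‖ := by linarith [V.one_le_farRadius]
  unfold poleSum
  refine (norm_sum_le _ _).trans ?_
  rw [Finset.mul_sum, Finset.sum_div]
  refine Finset.sum_le_sum fun p _ => ?_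
  rw [norm_div]
  calc ‖φ p‖ / ‖x - V.z p‖ ≤ ‖φ p‖ / (‖x‖ / 2) := by
        gcongr
        exact (V.far_sub hx p).2
    _ = _ := by field_simp

theorem exists_norm_u₀Ext_le :
    ∃ C : ℝ, 0 ≤ C ∧ ∀ x : ℂ, V.farRadius ≤ ‖x‖ → ‖V.u₀Ext x‖ ≤ C / ‖x‖ ^ 2 := by
  refine ⟨∑ p, 4 * (‖V.c p‖ * ‖V.z p‖), by positivity, fun x hx => ?_⟩
  have hx0 : 0 < ‖x‖ := by linarith [V.one_le_farRadius]
  have hxne : x ≠ 0 := norm_pos_iff.1 hx0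
  -- Since `∑ (c p + conj (c p)) = 0`, the term of order `1/x` can be subtracted for free.
  have key : V.u₀Ext x = ∑ p, (V.c p * V.z p / (x * (x - V.z p)) +
      conj (V.c p) * conj (V.z p) / (x * (x - conj (V.z p)))) := by
    have h1 : ∑ p, (V.c p + conj (V.c p)) / x = 0 := by
      rw [← Finset.sum_div, V.sum_eq_zero, zero_div]
    rw [← sub_eq_zero, u₀Ext, ← Finset.sum_sub_distrib, ← h1]
    refine Finset.sum_congr rfl fun p _ => ?_
    have h2 : x - V.z p ≠ 0 := norm_pos_iff.1 (by linarith [(V.far_sub hx p).1])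
    have h3 : x - conj (V.z p) ≠ 0 := norm_pos_iff.1 (by linarith [(V.far_sub_conj hx p).1])
    field_simp
    ring
  rw [key, Finset.sum_div]
  refine (norm_sum_le _ _).trans (Finset.sum_le_sum fun p _ => (norm_add_le _ _).trans ?_)
  simp only [norm_div, norm_mul, RCLike.norm_conj]
  have h2 := (V.far_sub hx p).2
  have h3 := (V.far_sub_conj hx p).2
  calc _ ≤ ‖V.c p‖ * ‖V.z p‖ / (‖x‖ * (‖x‖ / 2)) + ‖V.c p‖ * ‖V.z p‖ / (‖x‖ * (‖x‖ / 2)) := by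
        gcongr
    _ = _ := by field_simp; ring

theorem u₀Ext_ofReal (x : ℝ) : V.u₀Ext x = V.u₀ x := by
  simp [u₀Ext, u₀, map_div₀, map_sub]

end RationalPotential

/-! ### Ray integrals of the integrand and the improper integral -/

/-- If `rayIntegral g` is an antiderivative of `-g` along a real segment, then the integral over the
segment is a difference of ray integrals. -/
theorem rayIntegral_sub_rayIntegral {g : ℂ → ℂ} {r₁ r₂ : ℝ}
    (hd : ∀ t ∈ Set.uIcc r₁ r₂, HasDerivAt (rayIntegral g) (-g t) (t : ℂ))
    (hc : ContinuousOn (fun t : ℝ => g t) (Set.uIcc r₁ r₂)) :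
    ∫ t in r₁..r₂, g t = rayIntegral g r₁ - rayIntegral g r₂ := by
  have h := intervalIntegral.integral_eq_sub_of_hasDerivAt
    (f := fun t : ℝ => rayIntegral g t) (f' := fun t : ℝ => -g t) (a := r₁) (b := r₂)
    (fun t ht => (hd t ht).comp_ofReal) hc.neg.intervalIntegrable
  rw [intervalIntegral.integral_neg] at h
  linear_combination -h

theorem hasDerivAt_add_mul_I (x : ℂ) (s : ℝ) :
    HasDerivAt (fun s : ℝ => x + s * Complex.I) Complex.I s := by
  simpa using ((Complex.ofRealCLM.hasDerivAt (x := s)).mul_const Complex.I).const_add x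

namespace RationalPotential

variable {P : ℕ} (V : RationalPotential P)

theorem integrand_eq (ε lam : ℝ) (φ : Fin P → ℂ) (x : ℂ) :
    V.integrand ε lam φ x = V.expNeg ε lam x * V.poleSum φ x := rfl

/-- The analogue of `integrand` with all branch cuts pointing downwards. -/
def integrandUp (ε lam : ℝ) (φ : Fin P → ℂ) (x : ℂ) : ℂ := V.expNegUp ε lam x * V.poleSum φ x

theorem differentiableAt_integrand (ε lam : ℝ) (φ : Fin P → ℂ) {x : ℂ} (hx : x ∈ V.G) :
    DifferentiableAt ℂ (V.integrand ε lam φ) x :=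
  (V.hasDerivAt_expNeg ε lam hx).differentiableAt.mul
    (V.differentiableAt_poleSum φ (V.sub_z_ne_zero_of_mem_G hx))

theorem differentiableAt_integrandUp (ε lam : ℝ) (φ : Fin P → ℂ) {x : ℂ} (hx : x ∈ V.upDomain) :
    DifferentiableAt ℂ (V.integrandUp ε lam φ) x :=
  (V.hasDerivAt_expNegUp ε lam hx).differentiableAt.mul
    (V.differentiableAt_poleSum φ (V.sub_z_ne_zero_of_mem_upDomain hx))

theorem continuous_integrand_ofReal (ε lam : ℝ) (φ : Fin P → ℂ) :
    Continuous fun t : ℝ => V.integrand ε lam φ t :=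
  continuous_iff_continuousAt.2 fun t =>
    (V.differentiableAt_integrand ε lam φ (V.ofReal_mem_G t)).continuousAt.comp
      Complex.continuous_ofReal.continuousAt

theorem exists_norm_integrand_le {ε : ℝ} (hε : 0 < ε) (lam : ℝ) (φ : Fin P → ℂ) :
    ∃ K : ℝ, 0 ≤ K ∧ ∀ x : ℂ, V.farRadius ≤ ‖x‖ →
      ‖V.integrand ε lam φ x‖ ≤ K / ‖x‖ * Real.exp (-(-lam / ε) * x.im) := by
  obtain ⟨C, hC0, hC⟩ := V.exists_norm_expNeg_le hε lam
  refine ⟨C * (2 * ∑ p, ‖φ p‖), by positivity, fun x hx => ?_⟩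
  rw [integrand_eq, norm_mul]
  calc _ ≤ C * Real.exp (-(-lam / ε) * x.im) * (2 * (∑ p, ‖φ p‖) / ‖x‖) := by
        gcongr
        · exact hC x hx
        · exact V.norm_poleSum_le φ hx
    _ = _ := by ring

theorem exists_norm_integrandUp_le {ε : ℝ} (hε : 0 < ε) (lam : ℝ) (φ : Fin P → ℂ) :
    ∃ K : ℝ, 0 ≤ K ∧ ∀ x : ℂ, V.farRadius ≤ ‖x‖ →
      ‖V.integrandUp ε lam φ x‖ ≤ K / ‖x‖ * Real.exp (-(-lam / ε) * x.im) := by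
  obtain ⟨C, hC0, hC⟩ := V.exists_norm_expNegUp_le hε lam
  refine ⟨C * (2 * ∑ p, ‖φ p‖), by positivity, fun x hx => ?_⟩
  rw [integrandUp, norm_mul]
  calc _ ≤ C * Real.exp (-(-lam / ε) * x.im) * (2 * (∑ p, ‖φ p‖) / ‖x‖) := by
        gcongr
        · exact (hC x hx).1
        · exact V.norm_poleSum_le φ hx
    _ = _ := by ring

theorem norm_le_of_far_im {K κ : ℝ} (hK : 0 ≤ K) {w x : ℂ} (hx : V.farRadius ≤ x.im)
    (h : V.farRadius ≤ ‖x‖ → ‖w‖ ≤ K / ‖x‖ * Real.exp (-κ * x.im)) :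
    ‖w‖ ≤ K * Real.exp (-κ * x.im) := by
  have hx' : V.farRadius ≤ ‖x‖ := hx.trans ((le_abs_self _).trans (Complex.abs_im_le_norm x))
  refine (h hx').trans ?_
  gcongr
  exact div_le_self hK (V.one_le_farRadius.trans hx')

variable {ε lam : ℝ}

theorem decay_pos (hε : 0 < ε) (hlam : lam < 0) : 0 < -lam / ε := div_pos (by linarith) hε

theorem hasDerivAt_rayIntegral_integrand (hε : 0 < ε) (hlam : lam < 0) (φ : Fin P → ℂ)
    {x : ℂ} (hx : x ∈ V.offLines) :
    IntegrableOn (fun s : ℝ => V.integrand ε lam φ (x + s * Complex.I)) (Set.Ioi 0) ∧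
      HasDerivAt (rayIntegral (V.integrand ε lam φ)) (-V.integrand ε lam φ x) x := by
  obtain ⟨K, hK, hKb⟩ := V.exists_norm_integrand_le hε lam φ
  exact hasDerivAt_rayIntegral V.isOpen_offLines
    (fun x hx s _ => V.add_mul_I_mem_offLines hx s)
    (fun x hx => (V.differentiableAt_integrand ε lam φ
      (V.offLines_subset_G hx)).differentiableWithinAt)
    (decay_pos hε hlam) (fun z _ hY => V.norm_le_of_far_im hK hY (hKb z)) hx

theorem hasDerivAt_rayIntegral_integrandUp (hε : 0 < ε) (hlam : lam < 0) (φ : Fin P → ℂ)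
    {x : ℂ} (hx : x ∈ V.upDomain) :
    HasDerivAt (rayIntegral (V.integrandUp ε lam φ)) (-V.integrandUp ε lam φ x) x := by
  obtain ⟨K, hK, hKb⟩ := V.exists_norm_integrandUp_le hε lam φ
  exact (hasDerivAt_rayIntegral V.isOpen_upDomain
    (fun x hx s hs => V.add_mul_I_mem_upDomain hx hs)
    (fun x hx => (V.differentiableAt_integrandUp ε lam φ hx).differentiableWithinAt)
    (decay_pos hε hlam) (fun z _ hY => V.norm_le_of_far_im hK hY (hKb z)) hx).2

theorem norm_le_norm_add_mul_I {x : ℂ} (hx : 0 ≤ x.im) {s : ℝ} (hs : 0 ≤ s) :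
    ‖x‖ ≤ ‖x + s * Complex.I‖ := by
  rw [← sq_le_sq₀ (norm_nonneg _) (norm_nonneg _), Complex.sq_norm, Complex.sq_norm,
    Complex.normSq_apply, Complex.normSq_apply]
  simp
  nlinarith

/-- A bound for ray integrals far away from the poles. -/
theorem norm_rayIntegral_le_of_far (hκ : 0 < -lam / ε) {g : ℂ → ℂ} {K : ℝ} (hK : 0 ≤ K)
    (hg : ∀ x : ℂ, V.farRadius ≤ ‖x‖ → ‖g x‖ ≤ K / ‖x‖ * Real.exp (-(-lam / ε) * x.im))
    {x : ℂ} (hx : 0 ≤ x.im) (hxf : V.farRadius ≤ ‖x‖) :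
    ‖rayIntegral g x‖ ≤ K / ‖x‖ * Real.exp (-(-lam / ε) * x.im) / (-lam / ε) := by
  have hx0 : 0 < ‖x‖ := by linarith [V.one_le_farRadius]
  refine norm_rayIntegral_le hκ fun s hs => ?_
  have h1 := norm_le_norm_add_mul_I hx hs
  refine (hg _ (hxf.trans h1)).trans ?_
  rw [mul_assoc (K / ‖x‖), ← Real.exp_add]
  have him : (x + s * Complex.I).im = x.im + s := by simp
  rw [him]
  have : -(-lam / ε) * x.im + -(-lam / ε) * s = -(-lam / ε) * (x.im + s) := by ring
  rw [this]
  gcongr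

/-- `rayIntegral (integrandUp) / expNegUp`, a solution of the differential equation of `Phi`. -/
def rayQuotient (ε lam : ℝ) (φ : Fin P → ℂ) (x : ℂ) : ℂ :=
  rayIntegral (V.integrandUp ε lam φ) x / V.expNegUp ε lam x

theorem hasDerivAt_rayQuotient (hε : 0 < ε) (hlam : lam < 0) (φ : Fin P → ℂ)
    {x : ℂ} (hx : x ∈ V.upDomain) :
    HasDerivAt (V.rayQuotient ε lam φ)
      (Complex.I / ε * (lam + V.u₀Ext x) * V.rayQuotient ε lam φ x - V.poleSum φ x) x := by
  have h0 := V.expNegUp_ne_zero ε lam x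
  refine ((V.hasDerivAt_rayIntegral_integrandUp hε hlam φ hx).div
    (V.hasDerivAt_expNegUp ε lam hx) h0).congr_deriv ?_
  simp only [rayQuotient, integrandUp]
  field_simp
  ring

theorem exists_norm_rayQuotient_le (hε : 0 < ε) (hlam : lam < 0) (φ : Fin P → ℂ)
    : ∃ K : ℝ, ∀ x : ℂ, 0 ≤ x.im → V.farRadius ≤ ‖x‖ →
    ‖V.rayQuotient ε lam φ x‖ ≤ K / ‖x‖ := by
  obtain ⟨K, hK, hKb⟩ := V.exists_norm_integrandUp_le hε lam φ
  obtain ⟨C, hC0, hC⟩ := V.exists_norm_expNegUp_le hε lam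
  have hκ := decay_pos hε hlam
  refine ⟨K / (-lam / ε) * C, fun x hx hxf => ?_⟩
  rw [rayQuotient, norm_div, div_eq_mul_inv]
  calc _ ≤ K / ‖x‖ * Real.exp (-(-lam / ε) * x.im) / (-lam / ε) *
        (C * Real.exp ((-lam / ε) * x.im)) := by
        gcongr
        · exact V.norm_rayIntegral_le_of_far hκ hK hKb hx hxf
        · exact (hC x hxf).2
    _ = K / (-lam / ε) * C / ‖x‖ *
        (Real.exp (-(-lam / ε) * x.im) * Real.exp ((-lam / ε) * x.im)) := by ring
    _ = _ := by rw [← Real.exp_add]; simp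

/-- Both functions are antiderivatives of the same rational function, so they differ by a constant
along a vertical line that meets no cut. -/
theorem f_sub_fUp_add_mul_I {x : ℂ} (hx : x ∈ V.offLines) (s : ℝ) :
    V.f (x + s * Complex.I) - V.fUp (x + s * Complex.I) = V.f x - V.fUp x := by
  have hd : ∀ s : ℝ, HasDerivAt
      (fun s : ℝ => V.f (x + s * Complex.I) - V.fUp (x + s * Complex.I)) 0 s := by
    intro s
    have hm := V.add_mul_I_mem_offLines hx s
    have h1 := (V.hasDerivAt_f (V.offLines_subset_G hm)).sub
      (V.hasDerivAt_fUp (V.offLines_subset_upDomain hm))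
    rw [sub_self] at h1
    simpa using! HasDerivAt.comp_of_eq s h1 (hasDerivAt_add_mul_I x s) rfl
  have := is_const_of_deriv_eq_zero (fun s => (hd s).differentiableAt) (fun s => (hd s).deriv) s 0
  simpa using this

/-- Turning the cuts downwards multiplies the exponential by one constant along the whole ray, and
the quotient by the exponential does not see it. The right-hand quotient, unlike the left side,
makes sense across the upward cuts. -/
theorem rayIntegral_integrand_eq (φ : Fin P → ℂ) {x : ℂ} (hx : x ∈ V.offLines) :
    rayIntegral (V.integrand ε lam φ) x = V.expNeg ε lam x * V.rayQuotient ε lam φ x := by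
  have h0 := V.expNegUp_ne_zero ε lam x
  have h1 : ∀ s : ℝ, V.integrand ε lam φ (x + s * Complex.I) * Complex.I =
      V.expNeg ε lam x / V.expNegUp ε lam x *
        (V.integrandUp ε lam φ (x + s * Complex.I) * Complex.I) := by
    intro s
    have h2 := V.f_sub_fUp_add_mul_I hx s
    have h3 : V.expNeg ε lam (x + s * Complex.I) * V.expNegUp ε lam x =
        V.expNeg ε lam x * V.expNegUp ε lam (x + s * Complex.I) := by
      simp only [expNeg, expNegUp, h, ← Complex.exp_add]
      congr 1
      linear_combination (-Complex.I / ε) * h2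
    rw [integrand_eq, integrandUp]
    field_simp
    linear_combination V.poleSum φ (x + s * Complex.I) * h3
  simp only [rayIntegral, h1]
  rw [integral_const_mul, rayQuotient, rayIntegral]
  ring

/-- The integral of `integrand` over a real segment that contains no abscissa of a pole. -/
theorem integral_integrand_eq (hε : 0 < ε) (hlam : lam < 0) (φ : Fin P → ℂ)
    {r₁ r₂ : ℝ} (hr : ∀ p, (V.z p).re ∉ Set.uIcc r₁ r₂) :
    ∫ t in r₁..r₂, V.integrand ε lam φ t =
      rayIntegral (V.integrand ε lam φ) r₁ - rayIntegral (V.integrand ε lam φ) r₂ :=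
  rayIntegral_sub_rayIntegral (fun t ht => (V.hasDerivAt_rayIntegral_integrand hε hlam φ
    (fun p hp => hr p (by rw [← hp]; simpa using ht))).2)
    (V.continuous_integrand_ofReal ε lam φ).continuousOn

theorem tendsto_rayIntegral_integrand_atTop (hε : 0 < ε) (hlam : lam < 0) (φ : Fin P → ℂ) :
    Tendsto (fun R : ℝ => rayIntegral (V.integrand ε lam φ) ((-R : ℝ) : ℂ)) atTop (𝓝 0) := by
  obtain ⟨K, hK, hKb⟩ := V.exists_norm_integrand_le hε lam φ
  have hκ := decay_pos hε hlam
  have h0 : Tendsto (fun R : ℝ => K / (-lam / ε) / R) atTop (𝓝 0) :=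
    tendsto_const_nhds.div_atTop tendsto_id
  refine squeeze_zero_norm' ?_ h0
  filter_upwards [eventually_ge_atTop V.farRadius] with R hR
  have hR0 : 0 < R := by linarith [V.one_le_farRadius]
  have hn : ‖((-R : ℝ) : ℂ)‖ = R := by
    rw [Complex.norm_real, norm_neg, Real.norm_of_nonneg hR0.le]
  have := V.norm_rayIntegral_le_of_far hκ hK hKb (x := ((-R : ℝ) : ℂ)) (by simp)
    (by rw [hn]; exact hR)
  rw [hn, Complex.ofReal_im, mul_zero, Real.exp_zero] at this
  calc _ ≤ _ := this
    _ = _ := by ring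

/-- Convergence and value of the improper integral in the definition of `Phi`. -/
theorem tendsto_integral_integrand (hε : 0 < ε) (hlam : lam < 0) (φ : Fin P → ℂ)
    (S : V.Abscissae) (x : ℝ) :
    Tendsto (fun R : ℝ => ∫ t in (-R)..x, V.integrand ε lam φ t) atTop
      (𝓝 (-rayIntegral (V.integrand ε lam φ) S.a + ∫ t in S.a..x, V.integrand ε lam φ t)) := by
  have hi : ∀ a b : ℝ, IntervalIntegrable (fun t : ℝ => V.integrand ε lam φ t) volume a b :=
    fun a b => (V.continuous_integrand_ofReal ε lam φ).intervalIntegrable a b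
  -- No pole lies over `[-R, a]`, so that part is a difference of ray integrals, of which the one at
  -- `-R` tends to zero. This is where the conditionally convergent integral gets its limit.
  have h1 : ∀ᶠ R : ℝ in atTop, rayIntegral (V.integrand ε lam φ) ((-R : ℝ) : ℂ) +
      (-rayIntegral (V.integrand ε lam φ) S.a + ∫ t in S.a..x, V.integrand ε lam φ t) =
      ∫ t in (-R)..x, V.integrand ε lam φ t := by
    filter_upwards [eventually_ge_atTop (-S.a)] with R hR
    rw [← intervalIntegral.integral_add_adjacent_intervals (hi (-R) S.a) (hi S.a x),
      V.integral_integrand_eq hε hlam φ (r₁ := -R) (r₂ := S.a)]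
    · ring
    · intro p hp
      rw [Set.uIcc_of_le (by linarith)] at hp
      linarith [hp.2, S.a_lt p]
  have h2 := (V.tendsto_rayIntegral_integrand_atTop hε hlam φ).add_const
    (-rayIntegral (V.integrand ε lam φ) S.a + ∫ t in S.a..x, V.integrand ε lam φ t)
  rw [zero_add] at h2
  exact h2.congr' h1

/-! ### Exceptional indices: no branching at the pole -/

/-- The antiderivative `f` without its logarithm at `z m`. -/
def fErase (m : Fin P) (x : ℂ) : ℂ :=
  (∑ p ∈ Finset.univ.erase m,
    V.c p * (Complex.log (Complex.I * (x - V.z p)) + Real.pi * Complex.I / 2)) +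
  ∑ p, conj (V.c p) *
    (Complex.log (-Complex.I * (x - conj (V.z p))) - Real.pi * Complex.I / 2)

theorem f_eq_add_fErase (m : Fin P) (x : ℂ) :
    V.f x = V.c m * (Complex.log (Complex.I * (x - V.z m)) + Real.pi * Complex.I / 2) +
      V.fErase m x := by
  rw [f, fErase, ← add_assoc, Finset.add_sum_erase _ (fun p => V.c p *
    (Complex.log (Complex.I * (x - V.z p)) + Real.pi * Complex.I / 2)) (Finset.mem_univ m),
    Finset.sum_add_distrib]

/-- The vertical strip around `z m`, from the tip of the lower cut upwards, where `fErase m` is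
holomorphic. -/
def eraseDomain (m : Fin P) : Set ℂ :=
  {x | (∀ p, p ≠ m → x.re ≠ (V.z p).re) ∧ -(V.z m).im < x.im}

theorem isOpen_eraseDomain (m : Fin P) : IsOpen (V.eraseDomain m) := by
  have : V.eraseDomain m = (⋂ p, ⋂ (_ : p ≠ m), {x : ℂ | x.re ≠ (V.z p).re}) ∩
      {x : ℂ | -(V.z m).im < x.im} := by
    ext; simp [eraseDomain]
  rw [this]
  refine IsOpen.inter ?_ (isOpen_lt continuous_const Complex.continuous_im)
  exact isOpen_iInter_of_finite fun p => isOpen_iInter_of_finite fun _ =>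
    isOpen_ne_fun Complex.continuous_re continuous_const

theorem differentiableAt_fErase {m : Fin P} {x : ℂ} (hx : x ∈ V.eraseDomain m) :
    DifferentiableAt ℂ (V.fErase m) x := by
  unfold fErase
  refine DifferentiableAt.add (DifferentiableAt.fun_sum fun p hp => ?_)
    (DifferentiableAt.fun_sum fun p _ => ?_)
  · have hpm := Finset.ne_of_mem_erase hp
    exact ((hasDerivAt_log_const_mul_sub Complex.I_ne_zero (I_mul_sub_mem_slitPlane
      fun h => absurd h (hx.1 p hpm))).differentiableAt.add_const _).const_mul _
  · refine ((hasDerivAt_log_const_mul_sub (neg_ne_zero.2 Complex.I_ne_zero)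
      (neg_I_mul_sub_mem_slitPlane fun h => ?_)).differentiableAt.sub_const _).const_mul _
    by_cases hpm : p = m
    · subst hpm; simpa using hx.2
    · exact absurd (by simpa using h) (hx.1 p hpm)

/-- The factor of `expNeg` that is holomorphic and nonvanishing at `z m`. -/
def expErase (ε lam : ℝ) (m : Fin P) (x : ℂ) : ℂ :=
  Complex.exp (-Complex.I * (lam * x + V.fErase m x) / ε)

theorem differentiableAt_expErase (ε lam : ℝ) {m : Fin P} {x : ℂ} (hx : x ∈ V.eraseDomain m) :
    DifferentiableAt ℂ (V.expErase ε lam m) x :=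
  (hasDerivAt_exp_phase ε lam (V.differentiableAt_fErase hx).hasDerivAt).differentiableAt

/-- In the exceptional case `expNeg` is single-valued near `z m`. -/
theorem expNeg_eq_pow_mul {m : Fin P} {N : ℕ} (hN : Complex.I * V.c m / ε = -(N : ℂ)) {x : ℂ}
    (hx : x ≠ V.z m) :
    V.expNeg ε lam x = (V.z m - x) ^ N * V.expErase ε lam m x := by
  have h0 : Complex.I * (x - V.z m) ≠ 0 := mul_ne_zero Complex.I_ne_zero (sub_ne_zero.2 hx)
  -- The shift by `πi/2` turns `i(x - z)` into `i · i(x - z) = z - x`. As `-i c_m/ε = N` is an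
  -- integer, only the `N`-th power of this exponential appears, so the branch of the logarithm
  -- drops out.
  have h1 : Complex.exp (Complex.log (Complex.I * (x - V.z m)) + Real.pi * Complex.I / 2) =
      V.z m - x := by
    rw [Complex.exp_add, Complex.exp_log h0, mul_div_right_comm, Complex.exp_pi_div_two_mul_I]
    linear_combination (x - V.z m) * Complex.I_sq
  rw [expNeg, h, f_eq_add_fErase _ m, expErase, ← h1, ← Complex.exp_nat_mul, ← Complex.exp_add]
  congr 1
  linear_combination -(Complex.log (Complex.I * (x - V.z m)) + Real.pi * Complex.I / 2) * hN

/-- The holomorphic continuation of `integrand` through the cut above `z m`, in the exceptional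
case. -/
def integrandErase (ε lam : ℝ) (m : Fin P) (N : ℕ) (φ : Fin P → ℂ) (x : ℂ) : ℂ :=
  V.expErase ε lam m x * (-(V.z m - x) ^ (N - 1) * φ m +
    (V.z m - x) ^ N * ∑ p ∈ Finset.univ.erase m, φ p / (x - V.z p))

theorem integrand_eq_integrandErase {m : Fin P} {N : ℕ} (hN0 : 0 < N)
    (hN : Complex.I * V.c m / ε = -(N : ℂ)) (φ : Fin P → ℂ) {x : ℂ} (hx : x ≠ V.z m) :
    V.integrand ε lam φ x = V.integrandErase ε lam m N φ x := by
  -- `N` is positive, so one factor of the zero cancels the simple pole `φ m / (x - z m)`.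
  obtain ⟨n, rfl⟩ : ∃ n, N = n + 1 := ⟨N - 1, by omega⟩
  have hx' := sub_ne_zero.2 hx
  rw [integrand_eq, V.expNeg_eq_pow_mul hN hx, poleSum, integrandErase,
    ← Finset.add_sum_erase _ _ (Finset.mem_univ m)]
  simp only [Nat.add_sub_cancel]
  field_simp
  ring

theorem differentiableAt_integrandErase (ε lam : ℝ) (N : ℕ) (φ : Fin P → ℂ) {m : Fin P} {x : ℂ}
    (hx : x ∈ V.eraseDomain m) : DifferentiableAt ℂ (V.integrandErase ε lam m N φ) x := by
  refine (V.differentiableAt_expErase ε lam hx).mul (DifferentiableAt.add (by fun_prop)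
    (DifferentiableAt.mul (by fun_prop) (DifferentiableAt.fun_sum fun p hp => ?_)))
  refine (differentiableAt_const _).div (by fun_prop) fun h => ?_
  rw [sub_eq_zero] at h
  exact hx.1 p (Finset.ne_of_mem_erase hp) (by rw [h])

theorem hasDerivAt_rayIntegral_integrandErase (hε : 0 < ε) (hlam : lam < 0) {m : Fin P} {N : ℕ}
    (hN0 : 0 < N) (hN : Complex.I * V.c m / ε = -(N : ℂ)) (φ : Fin P → ℂ) {x : ℂ}
    (hx : x ∈ V.eraseDomain m) :
    HasDerivAt (rayIntegral (V.integrandErase ε lam m N φ)) (-V.integrandErase ε lam m N φ x) x := by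
  obtain ⟨K, hK, hKb⟩ := V.exists_norm_integrand_le hε lam φ
  refine (hasDerivAt_rayIntegral (V.isOpen_eraseDomain m) (fun x hx s hs => ⟨?_, ?_⟩)
    (fun x hx => (V.differentiableAt_integrandErase ε lam N φ hx).differentiableWithinAt)
    (decay_pos hε hlam) (K := K) (Y := V.farRadius) (fun z _ hY => ?_) hx).2
  · simpa using hx.1
  · have := hx.2
    simp; linarith
  · refine V.norm_le_of_far_im hK hY fun hz => ?_
    rw [← V.integrand_eq_integrandErase hN0 hN φ]
    · exact hKb z hz
    · rintro rfl
      have := V.norm_z_le_farRadius m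
      linarith [norm_nonneg (V.z m)]

theorem rayIntegral_integrandErase_eq {m : Fin P} {N : ℕ}
    (hN0 : 0 < N) (hN : Complex.I * V.c m / ε = -(N : ℂ)) (φ : Fin P → ℂ) {x : ℂ}
    (hx : x.re ≠ (V.z m).re) :
    rayIntegral (V.integrandErase ε lam m N φ) x = rayIntegral (V.integrand ε lam φ) x := by
  unfold rayIntegral
  congr 1
  funext s
  rw [V.integrand_eq_integrandErase hN0 hN φ]
  intro h
  exact hx (by rw [← h]; simp)

/-- In the exceptional case the ray integrals do not jump across the cut above `z m`. -/
theorem integral_integrand_eq_of_exceptional (hε : 0 < ε) (hlam : lam < 0) {m : Fin P}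
    (hm : V.IsExceptional ε m) (φ : Fin P → ℂ) {r₁ r₂ : ℝ}
    (hr : ∀ p, p ≠ m → (V.z p).re ∉ Set.uIcc r₁ r₂) (hr₁ : r₁ ≠ (V.z m).re)
    (hr₂ : r₂ ≠ (V.z m).re) :
    ∫ t in r₁..r₂, V.integrand ε lam φ t =
      rayIntegral (V.integrand ε lam φ) r₁ - rayIntegral (V.integrand ε lam φ) r₂ := by
  obtain ⟨N, hN0, hN⟩ := hm
  have hmem : ∀ t ∈ Set.uIcc r₁ r₂, (t : ℂ) ∈ V.eraseDomain m := fun t ht =>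
    ⟨fun p hp h => hr p hp (by rw [← h]; simpa using ht), by simpa using V.im_pos m⟩
  have h1 := rayIntegral_sub_rayIntegral (g := V.integrandErase ε lam m N φ) (r₁ := r₁) (r₂ := r₂)
    (fun t ht => V.hasDerivAt_rayIntegral_integrandErase hε hlam hN0 hN φ (hmem t ht))
    (fun t ht => ((V.differentiableAt_integrandErase ε lam N φ (hmem t ht)).continuousAt.comp
      Complex.continuous_ofReal.continuousAt).continuousWithinAt)
  rw [V.rayIntegral_integrandErase_eq hN0 hN φ (by simpa using hr₁),
    V.rayIntegral_integrandErase_eq hN0 hN φ (by simpa using hr₂)] at h1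
  rw [← h1]
  refine intervalIntegral.integral_congr fun t _ => V.integrand_eq_integrandErase hN0 hN φ ?_
  intro h
  have := congrArg Complex.im h
  simp at this
  linarith [V.im_pos m]

/-! ### Contour integrals and the linear relations -/

theorem offLines_of_abscissa_a (S : V.Abscissae) : (S.a : ℂ) ∈ V.offLines := fun p => by
  simpa using (S.a_lt p).ne

theorem offLines_of_abscissa_b (S : V.Abscissae) (m : Fin P) : (S.b m : ℂ) ∈ V.offLines := by
  intro p
  rcases le_or_gt p m with hp | hp
  · have := V.re_strictMono.monotone hp
    simpa using (lt_of_le_of_lt this (S.lt_b m)).ne'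
  · simpa using (S.b_lt m p hp).ne

/-- Transfers integrability of `integrand` to the individual matrix entries, which the splitting of
the integral of a sum requires. -/
theorem integrand_single (p : Fin P) :
    V.integrand ε lam (Pi.single p 1) = fun w => V.expNeg ε lam w / (w - V.z p) := by
  funext w
  simp [integrand, Pi.single_apply, div_eq_mul_inv]

theorem integrand_eq_sum (φ : Fin P → ℂ) (w : ℂ) :
    V.integrand ε lam φ w = ∑ p, φ p * (V.expNeg ε lam w / (w - V.z p)) := by
  rw [integrand, Finset.mul_sum]
  exact Finset.sum_congr rfl fun p _ => by ring

theorem verticalRay_integrand_eq_sum (hε : 0 < ε) (hlam : lam < 0) (φ : Fin P → ℂ) {r : ℝ}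
    (hr : (r : ℂ) ∈ V.offLines) :
    verticalRay (V.integrand ε lam φ) r =
      ∑ p, φ p * verticalRay (fun w => V.expNeg ε lam w / (w - V.z p)) r := by
  simp only [verticalRay, integrand_eq_sum, Finset.sum_mul]
  rw [integral_finsetSum]
  · refine Finset.sum_congr rfl fun p _ => ?_
    rw [← integral_const_mul]
    simp only [mul_assoc]
  · intro p _
    have := (V.hasDerivAt_rayIntegral_integrand hε hlam (Pi.single p 1) hr).1
    rw [integrand_single] at this
    exact (this.const_mul (φ p)).mul_const _

theorem intervalIntegral_integrand_eq_sum (φ : Fin P → ℂ) (r₁ r₂ : ℝ) :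
    ∫ t in r₁..r₂, V.integrand ε lam φ t =
      ∑ p, φ p * ∫ t in r₁..r₂, V.expNeg ε lam t / (t - V.z p) := by
  simp only [integrand_eq_sum]
  rw [intervalIntegral.integral_finsetSum]
  · simp only [intervalIntegral.integral_const_mul]
  · intro p _
    have := (V.continuous_integrand_ofReal ε lam (Pi.single p 1)).intervalIntegrable
      (μ := volume) r₁ r₂
    rw [integrand_single] at this
    exact this.const_mul (φ p)

/-- In the exceptional case `integrand` is integrable up to `z m`. -/
theorem intervalIntegrable_integrand_of_exceptional {m : Fin P} (hm : V.IsExceptional ε m)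
    (φ : Fin P → ℂ) :
    IntervalIntegrable (fun s : ℝ => V.integrand ε lam φ ((V.z m).re + s * Complex.I)) volume
      0 (V.z m).im := by
  obtain ⟨N, hN0, hN⟩ := hm
  have hc : ContinuousOn (fun s : ℝ => V.integrandErase ε lam m N φ ((V.z m).re + s * Complex.I))
      (Set.uIcc 0 (V.z m).im) := by
    intro s hs
    rw [Set.uIcc_of_le (V.im_pos m).le] at hs
    have hmem : ((V.z m).re + s * Complex.I : ℂ) ∈ V.eraseDomain m := by
      refine ⟨fun p hp => ?_, ?_⟩
      · simpa using fun h => hp (V.re_strictMono.injective h.symm)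
      · have := V.im_pos m
        simp; linarith [hs.1]
    exact (ContinuousAt.comp (f := fun s : ℝ => ((V.z m).re + s * Complex.I : ℂ))
      (V.differentiableAt_integrandErase ε lam N φ hmem).continuousAt
      (by fun_prop)).continuousWithinAt
  refine hc.intervalIntegrable.congr_ae ?_
  have hne : ∀ᵐ s : ℝ ∂(volume.restrict (Set.uIoc 0 (V.z m).im)), s ≠ (V.z m).im :=
    ae_restrict_of_ae (Measure.ae_ne volume _)
  filter_upwards [hne] with s hs
  refine (V.integrand_eq_integrandErase hN0 hN φ fun h => hs ?_).symm
  have := congrArg Complex.im h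
  simpa using this

theorem verticalSegment_integrand_eq_sum {m : Fin P} (hm : V.IsExceptional ε m)
    (φ : Fin P → ℂ) :
    verticalSegment (V.integrand ε lam φ) (V.z m).re (V.z m).im = ∑ p, φ p *
      verticalSegment (fun w => V.expNeg ε lam w / (w - V.z p)) (V.z m).re (V.z m).im := by
  simp only [verticalSegment, integrand_eq_sum, Finset.sum_mul]
  rw [intervalIntegral.integral_finsetSum]
  · refine Finset.sum_congr rfl fun p _ => ?_
    rw [← intervalIntegral.integral_const_mul]
    simp only [mul_assoc]
  · intro p _
    have := V.intervalIntegrable_integrand_of_exceptional (lam := lam) hm (Pi.single p 1)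
    rw [integrand_single] at this
    exact (this.const_mul (φ p)).mul_const _

/-- Linearity of the contour integral in `φ`. The end point `z m` of `ℓ₀` is harmless because this
contour is used only in the exceptional case, where the integrand extends continuously to it. -/
theorem integralC_integrand (hε : 0 < ε) (hlam : lam < 0) (S : V.Abscissae) (φ : Fin P → ℂ)
    (m : Fin P) :
    V.integralC ε S m (V.integrand ε lam φ) = (V.matrixA ε S lam).mulVec φ m := by
  simp only [Matrix.mulVec, dotProduct, matrixA, Matrix.of_apply, integralC]
  have ha := V.verticalRay_integrand_eq_sum hε hlam φ (V.offLines_of_abscissa_a S)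
  split_ifs with hm
  · simp only [integralEll]
    rw [ha, V.intervalIntegral_integrand_eq_sum, V.verticalSegment_integrand_eq_sum hm,
      ← Finset.sum_neg_distrib, ← Finset.sum_add_distrib, ← Finset.sum_add_distrib]
    exact Finset.sum_congr rfl fun p _ => by ring
  · simp only [integralU]
    rw [ha, V.intervalIntegral_integrand_eq_sum,
      V.verticalRay_integrand_eq_sum hε hlam φ (V.offLines_of_abscissa_b S m),
      ← Finset.sum_neg_distrib, ← Finset.sum_add_distrib, ← Finset.sum_add_distrib]
    exact Finset.sum_congr rfl fun p _ => by ring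

/-- Under the linear relations `A φ = 0`, the contour from `a + i∞` through the real axis to
`r + i∞` does not contribute. -/
theorem integral_integrand_eq_of_mulVec_eq_zero (hε : 0 < ε) (hlam : lam < 0) (S : V.Abscissae)
    {φ : Fin P → ℂ} (hφ : (V.matrixA ε S lam).mulVec φ = 0) {r : ℝ} (hr : (r : ℂ) ∈ V.offLines) :
    ∫ t in S.a..r, V.integrand ε lam φ t =
      rayIntegral (V.integrand ε lam φ) S.a - rayIntegral (V.integrand ε lam φ) r := by
  have hi : ∀ a b : ℝ, IntervalIntegrable (fun t : ℝ => V.integrand ε lam φ t) volume a b :=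
    fun a b => (V.continuous_integrand_ofReal ε lam φ).intervalIntegrable a b
  -- Induction on the number of poles to the left of `r`; the last of them, `m`, decides how its cut
  -- is passed.
  induction hn : (Finset.univ.filter fun p => (V.z p).re < r).card using Nat.strong_induction_on
    generalizing r with
  | _ n ih =>
    subst hn
    have hr' : ∀ p, r ≠ (V.z p).re := fun p => by simpa using hr p
    rcases (Finset.univ.filter fun p => (V.z p).re < r).eq_empty_or_nonempty with he | hne
    · refine V.integral_integrand_eq hε hlam φ fun p hp => ?_
      have h1 : r ≤ (V.z p).re := by
        by_contra hlt
        have : p ∈ (Finset.univ.filter fun p => (V.z p).re < r) := by simpa using hlt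
        simp [he] at this
      have h2 := S.a_lt p
      rcases (Set.mem_uIcc.1 hp) with h | h
      · exact hr' p (le_antisymm h1 h.2)
      · linarith [h.2]
    · set m := (Finset.univ.filter fun p => (V.z p).re < r).max' hne with hmdef
      have hmr : (V.z m).re < r := by
        have := Finset.max'_mem _ hne
        simpa using (Finset.mem_filter.1 this).2
      have hgt : ∀ p, m < p → r < (V.z p).re := by
        intro p hp
        by_contra hle
        have hlt : (V.z p).re < r := lt_of_le_of_ne (not_lt.1 hle) (hr' p).symm
        exact absurd (Finset.le_max' _ p (by simpa using hlt)) (not_le.2 hp)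
      by_cases hm : V.IsExceptional ε m
      -- Exceptional case: `r₀` lies in the strip just before `z m`. The induction hypothesis
      -- reaches `r₀`, and there is no jump between `r₀` and `r`.
      · obtain ⟨r₀, hr₀m, hr₀⟩ : ∃ r₀, r₀ < (V.z m).re ∧ ∀ p, p < m → (V.z p).re < r₀ := by
          have h1 : ∀ᶠ t in 𝓝[<] (V.z m).re, ∀ p, p < m → (V.z p).re < t := by
            rw [eventually_all]
            intro p
            by_cases hp : p < m
            · have := V.re_strictMono hp
              filter_upwards [mem_nhdsWithin_of_mem_nhds (lt_mem_nhds this)] with t ht _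
              exact ht
            · exact Eventually.of_forall fun t h => absurd h hp
          obtain ⟨t, ht, ht'⟩ := (h1.and self_mem_nhdsWithin).exists
          exact ⟨t, ht', ht⟩
        have hge : ∀ p, m ≤ p → r₀ < (V.z p).re := fun p hp =>
          hr₀m.trans_le (V.re_strictMono.monotone hp)
        have hoff : (r₀ : ℂ) ∈ V.offLines := by
          intro p
          rcases lt_or_ge p m with hp | hp
          · simpa using (hr₀ p hp).ne'
          · simpa using (hge p hp).ne
        have hcard : (Finset.univ.filter fun p => (V.z p).re < r₀).card <
            (Finset.univ.filter fun p => (V.z p).re < r).card := by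
          refine Finset.card_lt_card (Finset.ssubset_iff_of_subset ?_ |>.2 ⟨m, ?_, ?_⟩)
          · intro p hp
            simp only [Finset.mem_filter, Finset.mem_univ, true_and] at hp ⊢
            linarith
          · simpa using hmr
          · simpa using hr₀m.le
        rw [← intervalIntegral.integral_add_adjacent_intervals (hi S.a r₀) (hi r₀ r),
          ih _ hcard hoff rfl, V.integral_integrand_eq_of_exceptional hε hlam hm φ
            (r₁ := r₀) (r₂ := r) ?_ hr₀m.ne hmr.ne']
        · ring
        · intro p hp hmem
          rw [Set.uIcc_of_le (by linarith)] at hmem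
          rcases lt_or_gt_of_ne hp with h | h
          · linarith [hr₀ p h, hmem.1]
          · linarith [hgt p h, hmem.2]
      -- Non-exceptional case: row `m` is already the claim at `b m`, and `b m` and `r` lie in the
      -- same strip, so the induction hypothesis is not needed.
      · have h0 := congrFun hφ m
        rw [← V.integralC_integrand hε hlam S φ m, integralC, if_neg hm] at h0
        simp only [integralU, Pi.zero_apply] at h0
        rw [← intervalIntegral.integral_add_adjacent_intervals (hi S.a (S.b m)) (hi (S.b m) r),
          V.integral_integrand_eq hε hlam φ (r₁ := S.b m) (r₂ := r)]
        · change -rayIntegral _ _ + _ + rayIntegral _ _ = 0 at h0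
          linear_combination h0
        · intro p hmem
          rcases le_or_gt p m with hp | hp
          · have h1 : (V.z p).re ≤ (V.z m).re := V.re_strictMono.monotone hp
            have h2 := S.lt_b m
            rcases Set.mem_uIcc.1 hmem with h | h <;> linarith [h.1]
          · have h1 := hgt p hp
            have h2 := S.b_lt m p hp
            rcases Set.mem_uIcc.1 hmem with h | h <;> linarith [h.2]

/-! ### `Phi` as a ray quotient -/

/-- The integral of `integrand` from `-∞` to `x` in the definition of `Phi`. -/
def leftIntegral (ε lam : ℝ) (φ : Fin P → ℂ) (x : ℂ) : ℂ :=
  limUnder atTop (fun R : ℝ => ∫ t in (-R)..x.re, V.integrand ε lam φ t)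
    + verticalSegment (V.integrand ε lam φ) x.re x.im

theorem leftIntegral_eq (hε : 0 < ε) (hlam : lam < 0) (S : V.Abscissae) (φ : Fin P → ℂ) (x : ℂ) :
    V.leftIntegral ε lam φ x = -rayIntegral (V.integrand ε lam φ) S.a +
      (∫ t in S.a..x.re, V.integrand ε lam φ t) +
      verticalSegment (V.integrand ε lam φ) x.re x.im := by
  rw [leftIntegral, (V.tendsto_integral_integrand hε hlam φ S x.re).limUnder_eq]

theorem expNeg_mul_Phi (φ : Fin P → ℂ) (x : ℂ) :
    V.expNeg ε lam x * V.Phi ε lam φ x = -(Complex.I / ε) * V.leftIntegral ε lam φ x := by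
  have h1 : V.expNeg ε lam x * Complex.exp (Complex.I * V.h lam x / ε) = 1 := by
    rw [expNeg, ← Complex.exp_add, ← Complex.exp_zero]
    congr 1
    ring
  rw [Phi, ← leftIntegral]
  linear_combination (-(Complex.I / ε) * V.leftIntegral ε lam φ x) * h1

theorem Phi_eq_div (φ : Fin P → ℂ) (x : ℂ) :
    V.Phi ε lam φ x = -(Complex.I / ε) * V.leftIntegral ε lam φ x / V.expNeg ε lam x := by
  rw [eq_div_iff (V.expNeg_ne_zero ε lam x), mul_comm, V.expNeg_mul_Phi]

theorem verticalSegment_eq {g F : ℂ → ℂ} {r y : ℝ}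
    (hF : ∀ s ∈ Set.uIcc 0 y, HasDerivAt F (g (r + s * Complex.I)) (r + s * Complex.I))
    (hg : ∀ s ∈ Set.uIcc 0 y, ContinuousAt g (r + s * Complex.I)) :
    verticalSegment g r y = F (r + y * Complex.I) - F r := by
  have := intervalIntegral.integral_eq_sub_of_hasDerivAt
    (f := fun s : ℝ => F (r + s * Complex.I))
    (f' := fun s : ℝ => g (r + s * Complex.I) * Complex.I) (a := 0) (b := y)
    (fun s hs => HasDerivAt.comp_of_eq s (hF s hs) (hasDerivAt_add_mul_I r s) rfl)
    (ContinuousOn.intervalIntegrable fun s hs => ContinuousAt.continuousWithinAt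
      ((ContinuousAt.comp (f := fun s : ℝ => (r + s * Complex.I : ℂ)) (hg s hs)
        (by fun_prop)).mul continuousAt_const))
  simpa [verticalSegment] using this

theorem leftIntegral_eq_neg_rayIntegral (hε : 0 < ε) (hlam : lam < 0) (S : V.Abscissae)
    {φ : Fin P → ℂ} (hφ : (V.matrixA ε S lam).mulVec φ = 0) {x : ℂ} (hx : x ∈ V.offLines) :
    V.leftIntegral ε lam φ x = -rayIntegral (V.integrand ε lam φ) x := by
  have hre : (x.re : ℂ) ∈ V.offLines := fun p => by simpa using hx p
  have hv : ∀ s : ℝ, (x.re + s * Complex.I : ℂ) ∈ V.offLines := V.add_mul_I_mem_offLines hre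
  rw [V.leftIntegral_eq hε hlam S, V.integral_integrand_eq_of_mulVec_eq_zero hε hlam S hφ hre,
    verticalSegment_eq (F := fun x => -rayIntegral (V.integrand ε lam φ) x)
      (fun s _ => by
        simpa using! (V.hasDerivAt_rayIntegral_integrand hε hlam φ (hv s)).2.neg)
      (fun s _ => (V.differentiableAt_integrand ε lam φ
        (V.offLines_subset_G (hv s))).continuousAt), Complex.re_add_im]
  ring

theorem Phi_eq_rayQuotient (hε : 0 < ε) (hlam : lam < 0) (S : V.Abscissae)
    {φ : Fin P → ℂ} (hφ : (V.matrixA ε S lam).mulVec φ = 0) {x : ℂ} (hx : x ∈ V.offLines) :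
    V.Phi ε lam φ x = Complex.I / ε * V.rayQuotient ε lam φ x := by
  rw [V.Phi_eq_div, V.leftIntegral_eq_neg_rayIntegral hε hlam S hφ hx,
    V.rayIntegral_integrand_eq φ hx, div_eq_iff (V.expNeg_ne_zero ε lam x)]
  ring

/-- Inside a strip this is the derivative of the ray integral. Below a pole, where the upward ray
runs into the singularity, a primitive of the integrand on a convex rectangle is used instead. -/
theorem hasDerivAt_leftIntegral (hε : 0 < ε) (hlam : lam < 0) (S : V.Abscissae)
    {φ : Fin P → ℂ} (hφ : (V.matrixA ε S lam).mulVec φ = 0) {x : ℂ} (hx : x ∈ V.G) :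
    HasDerivAt (V.leftIntegral ε lam φ) (V.integrand ε lam φ x) x := by
  by_cases hoff : x ∈ V.offLines
  · have h1 := (V.hasDerivAt_rayIntegral_integrand hε hlam φ hoff).2.neg
    rw [neg_neg] at h1
    refine h1.congr_of_eventuallyEq ?_
    filter_upwards [V.isOpen_offLines.mem_nhds hoff] with y hy
    exact V.leftIntegral_eq_neg_rayIntegral hε hlam S hφ hy
  · obtain ⟨p, hp⟩ : ∃ p, x.re = (V.z p).re := by simpa [offLines] using hoff
    have hxim := hx p hp
    obtain ⟨δ, hδ, hδb⟩ : ∃ δ > 0, ∀ t : ℝ, |t - (V.z p).re| < δ →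
        ∀ q, q ≠ p → t ≠ (V.z q).re := by
      have : ∀ᶠ t in 𝓝 (V.z p).re, ∀ q, q ≠ p → t ≠ (V.z q).re := by
        rw [eventually_all]
        intro q
        by_cases hq : q = p
        · exact Eventually.of_forall fun t h => absurd hq h
        · filter_upwards [isOpen_ne.mem_nhds
            (fun h => hq (V.re_strictMono.injective h.symm) : (V.z p).re ≠ (V.z q).re)] with t ht _
          exact ht
      exact Metric.eventually_nhds_iff.1 this
    -- A rectangle about the gap between `conj (z p)` and `z p`, too narrow to meet another cut. The
    -- path defining `leftIntegral w` can be entered on the real axis at `(z p).re` and stays in `T`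
    -- from there on.
    set T : Set ℂ := {w | |w.re - (V.z p).re| < δ} ∩ {w | |w.im| < (V.z p).im} with hT
    have hTo : IsOpen T := (isOpen_lt (by fun_prop) continuous_const).inter
      (isOpen_lt (by fun_prop) continuous_const)
    have hTc : Convex ℝ T := by
      have : T = Complex.re ⁻¹' (Metric.ball (V.z p).re δ) ∩
          Complex.im ⁻¹' (Metric.ball 0 (V.z p).im) := by
        ext w; simp [hT, Real.dist_eq]
      rw [this]
      exact ((convex_ball _ _).linear_preimage Complex.reLm).inter
        ((convex_ball _ _).linear_preimage Complex.imLm)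
    have hTG : T ⊆ V.G := by
      intro w hw q hq
      by_cases hqp : q = p
      · rw [hqp]; exact hw.2
      · exact absurd hq (hδb _ hw.1 q hqp)
    obtain ⟨F, hF⟩ := hTc.exists_forall_hasDerivWithinAt (f := V.integrand ε lam φ)
      (fun w hw => (V.differentiableAt_integrand ε lam φ (hTG hw)).differentiableWithinAt)
    have hF' : ∀ w ∈ T, HasDerivAt F (V.integrand ε lam φ w) w := fun w hw =>
      (hF w hw).hasDerivAt (hTo.mem_nhds hw)
    have hxT : x ∈ T := ⟨by simpa [hp] using hδ, hxim⟩
    have him := V.im_pos p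
    have hi : ∀ a b : ℝ, IntervalIntegrable (fun t : ℝ => V.integrand ε lam φ t) volume a b :=
      fun a b => (V.continuous_integrand_ofReal ε lam φ).intervalIntegrable a b
    have heq : ∀ w ∈ T, V.leftIntegral ε lam φ w = F w +
        (-rayIntegral (V.integrand ε lam φ) S.a +
          (∫ t in S.a..(V.z p).re, V.integrand ε lam φ t) - F ((V.z p).re : ℝ)) := by
      intro w hw
      have hseg : ∀ s ∈ Set.uIcc 0 w.im, (w.re + s * Complex.I : ℂ) ∈ T := by
        intro s hs
        have h1 : |s| ≤ |w.im| := by simpa using Set.abs_sub_left_of_mem_uIcc hs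
        refine ⟨by simpa using hw.1, ?_⟩
        simpa using lt_of_le_of_lt h1 hw.2
      have hreal : ∀ t ∈ Set.uIcc (V.z p).re w.re, (t : ℂ) ∈ T := by
        intro t ht
        have h1 := Set.abs_sub_left_of_mem_uIcc ht
        exact ⟨by simpa using lt_of_le_of_lt h1 hw.1, by simpa using him⟩
      have h2 := intervalIntegral.integral_eq_sub_of_hasDerivAt
        (f := fun t : ℝ => F t) (f' := fun t : ℝ => V.integrand ε lam φ t)
        (fun t ht => (hF' _ (hreal t ht)).comp_ofReal) (hi _ _)
      rw [V.leftIntegral_eq hε hlam S,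
        ← intervalIntegral.integral_add_adjacent_intervals (hi S.a (V.z p).re) (hi (V.z p).re w.re),
        h2, verticalSegment_eq (F := F) (fun s hs => hF' _ (hseg s hs)) (fun s hs =>
          (V.differentiableAt_integrand ε lam φ (hTG (hseg s hs))).continuousAt),
        Complex.re_add_im]
      ring
    refine ((hF' x hxT).add_const (-rayIntegral (V.integrand ε lam φ) S.a +
      (∫ t in S.a..(V.z p).re, V.integrand ε lam φ t) - F ((V.z p).re : ℝ))).congr_of_eventuallyEq ?_
    filter_upwards [hTo.mem_nhds hxT] with w hw
    exact heq w hw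

/-! ### Continuation through the upward cuts and the singularities at the poles -/

open Classical in
/-- The continuation of `Phi` through the cuts that go up from the poles. -/
def PhiUp (ε lam : ℝ) (φ : Fin P → ℂ) (x : ℂ) : ℂ :=
  if x ∈ V.upDomain then Complex.I / ε * V.rayQuotient ε lam φ x else V.Phi ε lam φ x

theorem PhiUp_eq_Phi (hε : 0 < ε) (hlam : lam < 0) (S : V.Abscissae)
    {φ : Fin P → ℂ} (hφ : (V.matrixA ε S lam).mulVec φ = 0) {x : ℂ} (hx : x ∈ V.G) :
    V.PhiUp ε lam φ x = V.Phi ε lam φ x := by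
  unfold PhiUp
  split_ifs with h
  · exact (V.Phi_eq_rayQuotient hε hlam S hφ (V.G_inter_upDomain_subset ⟨hx, h⟩)).symm
  · rfl

theorem PhiUp_eq_rayQuotient (φ : Fin P → ℂ) {x : ℂ} (hx : x ∈ V.upDomain) :
    V.PhiUp ε lam φ x = Complex.I / ε * V.rayQuotient ε lam φ x := if_pos hx

/-- The differential equation of `Phi` and its continuation. -/
theorem hasDerivAt_PhiUp (hε : 0 < ε) (hlam : lam < 0) (S : V.Abscissae)
    {φ : Fin P → ℂ} (hφ : (V.matrixA ε S lam).mulVec φ = 0) {x : ℂ}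
    (hx : x ∈ V.G ∪ V.upDomain) :
    HasDerivAt (V.PhiUp ε lam φ) (Complex.I / ε *
      ((lam + V.u₀Ext x) * V.PhiUp ε lam φ x - V.poleSum φ x)) x := by
  rcases hx with hx | hx
  · have h0 := V.expNeg_ne_zero ε lam x
    have h1 := ((V.hasDerivAt_leftIntegral hε hlam S hφ hx).const_mul (-(Complex.I / ε))).div
      (V.hasDerivAt_expNeg ε lam hx) h0
    rw [V.PhiUp_eq_Phi hε hlam S hφ hx, V.Phi_eq_div]
    refine (h1.congr_deriv ?_).congr_of_eventuallyEq ?_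
    · have hε' : (ε : ℂ) ≠ 0 := Complex.ofReal_ne_zero.2 hε.ne'
      rw [integrand_eq]
      field_simp
      ring
    · filter_upwards [V.isOpen_G.mem_nhds hx] with y hy
      rw [V.PhiUp_eq_Phi hε hlam S hφ hy, V.Phi_eq_div]
      rfl
  · rw [V.PhiUp_eq_rayQuotient φ hx]
    refine (((V.hasDerivAt_rayQuotient hε hlam φ hx).const_mul (Complex.I / ε)).congr_deriv
      (by ring)).congr_of_eventuallyEq ?_
    filter_upwards [V.isOpen_upDomain.mem_nhds hx] with y hy
    exact V.PhiUp_eq_rayQuotient φ hy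

theorem mem_G_union_upDomain {x : ℂ} (hx : 0 ≤ x.im) (hz : ∀ p, x ≠ V.z p) :
    x ∈ V.G ∪ V.upDomain := by
  by_cases hU : x ∈ V.upDomain
  · exact Or.inr hU
  · left
    obtain ⟨p, hp, hle⟩ : ∃ p, x.re = (V.z p).re ∧ x.im ≤ (V.z p).im := by
      simpa [upDomain] using hU
    have hlt : x.im < (V.z p).im := lt_of_le_of_ne hle fun h => hz p (Complex.ext hp h)
    intro q hq
    obtain rfl : p = q := V.re_strictMono.injective (hp.symm.trans hq)
    rwa [abs_of_nonneg hx]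

/-- The punctured continuation has a removable singularity at each `z m`, or a pole, and then the
index `m` is exceptional. -/
theorem PhiUp_analytic_or_pole (hε : 0 < ε) (hlam : lam < 0) (S : V.Abscissae)
    {φ : Fin P → ℂ} (hφ : (V.matrixA ε S lam).mulVec φ = 0) (m : Fin P) :
    (∃ k : ℂ → ℂ, AnalyticAt ℂ k (V.z m) ∧ V.PhiUp ε lam φ =ᶠ[𝓝[≠] (V.z m)] k) ∨
    ∃ n : ℕ, 0 < n ∧ Complex.I * V.c m / ε = -n ∧
      ∃ k : ℂ → ℂ, AnalyticAt ℂ k (V.z m) ∧ k (V.z m) ≠ 0 ∧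
        ∀ᶠ x in 𝓝[≠] (V.z m), (x - V.z m) ^ n * V.PhiUp ε lam φ x = k x := by
  have hm := V.im_pos m
  obtain ⟨r, hr, hrb⟩ : ∃ r > 0, Metric.ball (V.z m) r ⊆
      {x : ℂ | 0 < x.im ∧ ∀ q, q ≠ m → x ≠ V.z q} := by
    refine Metric.mem_nhds_iff.1 ?_
    refine Filter.inter_mem ((isOpen_lt continuous_const Complex.continuous_im).mem_nhds hm) ?_
    change ∀ᶠ x in 𝓝 (V.z m), ∀ q, q ≠ m → x ≠ V.z q
    rw [eventually_all]
    intro q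
    by_cases hq : q = m
    · exact Eventually.of_forall fun t h => absurd hq h
    · filter_upwards [isOpen_ne.mem_nhds
        (fun h => hq (V.re_strictMono.injective (congrArg Complex.re h).symm) : V.z m ≠ V.z q)] with t ht _
      exact ht
  have hconj : ∀ x ∈ Metric.ball (V.z m) r, ∀ p, x - conj (V.z p) ≠ 0 := by
    intro x hx p h
    rw [sub_eq_zero] at h
    have h1 := (hrb hx).1
    rw [h, Complex.conj_im] at h1
    linarith [V.im_pos p]
  have hsub : ∀ x ∈ Metric.ball (V.z m) r, ∀ p ∈ Finset.univ.erase m, x - V.z p ≠ 0 :=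
    fun x hx p hp => sub_ne_zero.2 ((hrb hx).2 p (Finset.ne_of_mem_erase hp))
  -- `A` and `B` are the coefficients of the equation of `PhiUp` multiplied by `x - z m`; only the
  -- `m`-th terms survive at `z m`, so `A (z m) = i c_m/ε`.
  set A : ℂ → ℂ := fun x => Complex.I / ε * (V.c m + (x - V.z m) * (lam +
    ((∑ p ∈ Finset.univ.erase m, V.c p / (x - V.z p)) +
      ∑ p, conj (V.c p) / (x - conj (V.z p))))) with hA
  set B : ℂ → ℂ := fun x => -(Complex.I / ε) * (φ m + (x - V.z m) *
    ∑ p ∈ Finset.univ.erase m, φ p / (x - V.z p)) with hB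
  have hAc : ContinuousOn A (Metric.ball (V.z m) r) := by
    have h1 : ContinuousOn (fun x => ∑ p ∈ Finset.univ.erase m, V.c p / (x - V.z p))
        (Metric.ball (V.z m) r) := continuousOn_finsetSum _ fun p hp =>
      continuousOn_const.div (by fun_prop) fun x hx => hsub x hx p hp
    have h2 : ContinuousOn (fun x => ∑ p, conj (V.c p) / (x - conj (V.z p)))
        (Metric.ball (V.z m) r) := continuousOn_finsetSum _ fun p _ =>
      continuousOn_const.div (by fun_prop) fun x hx => hconj x hx p
    fun_prop
  have hBc : ContinuousOn B (Metric.ball (V.z m) r) := by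
    have h1 : ContinuousOn (fun x => ∑ p ∈ Finset.univ.erase m, φ p / (x - V.z p))
        (Metric.ball (V.z m) r) := continuousOn_finsetSum _ fun p hp =>
      continuousOn_const.div (by fun_prop) fun x hx => hsub x hx p hp
    fun_prop
  have hAm : A (V.z m) = Complex.I * V.c m / ε := by
    simp only [hA, sub_self, zero_mul, add_zero]
    ring
  have key := analytic_or_pole_of_singular_ode (y := V.PhiUp ε lam φ) hr hAc hBc ?_
  · rwa [hAm] at key
  · intro x hx hxm
    have hz : ∀ p, x ≠ V.z p := fun p => by
      by_cases hp : p = m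
      · rwa [hp]
      · exact (hrb hx).2 p hp
    refine (V.hasDerivAt_PhiUp hε hlam S hφ
      (V.mem_G_union_upDomain (hrb hx).1.le hz)).congr_deriv ?_
    have h0 := sub_ne_zero.2 hxm
    rw [eq_div_iff h0]
    have hU : V.u₀Ext x = V.c m / (x - V.z m) + ((∑ p ∈ Finset.univ.erase m, V.c p / (x - V.z p)) +
        ∑ p, conj (V.c p) / (x - conj (V.z p))) := by
      rw [← add_assoc, Finset.add_sum_erase _ (fun p => V.c p / (x - V.z p)) (Finset.mem_univ m),
        u₀Ext, Finset.sum_add_distrib]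
    have hq : V.poleSum φ x = φ m / (x - V.z m) +
        ∑ p ∈ Finset.univ.erase m, φ p / (x - V.z p) := by
      rw [Finset.add_sum_erase _ (fun p => φ p / (x - V.z p)) (Finset.mem_univ m), poleSum]
    rw [hU, hq]
    simp only [hA, hB]
    generalize (∑ p ∈ Finset.univ.erase m, V.c p / (x - V.z p)) +
        ∑ p, conj (V.c p) / (x - conj (V.z p)) = a
    generalize ∑ p ∈ Finset.univ.erase m, φ p / (x - V.z p) = b
    field_simp
    ring

/-- A pole of order `n` would exactly compensate the zero of order `n` of `expNeg`, so `expNeg *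
Phi` would have a nonzero limit at `z m`. But this product is a multiple of `leftIntegral`, which
tends to the integral over `ℓ₀(z m)`, and that is zero by row `m`. -/
theorem PhiUp_analytic (hε : 0 < ε) (hlam : lam < 0) (S : V.Abscissae)
    {φ : Fin P → ℂ} (hφ : (V.matrixA ε S lam).mulVec φ = 0) (m : Fin P) :
    ∃ k : ℂ → ℂ, AnalyticAt ℂ k (V.z m) ∧ V.PhiUp ε lam φ =ᶠ[𝓝[≠] (V.z m)] k := by
  refine (V.PhiUp_analytic_or_pole hε hlam S hφ m).resolve_right ?_
  rintro ⟨n, hn0, hn, k, hk, hk0, hky⟩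
  have hexc : V.IsExceptional ε m := ⟨n, hn0, hn⟩
  have him := V.im_pos m
  -- The final vertical piece of `ℓ₀(z m)`, approaching `z m` from below and inside `G`.
  set γ : ℝ → ℂ := fun s => (V.z m).re + s * Complex.I with hγ
  have hγc : Continuous γ := by fun_prop
  have hγm : γ (V.z m).im = V.z m := Complex.re_add_im _
  have hγt : Tendsto γ (𝓝[<] (V.z m).im) (𝓝[≠] (V.z m)) := by
    refine tendsto_nhdsWithin_iff.2 ⟨?_, ?_⟩
    · have := hγc.tendsto (V.z m).im
      rw [hγm] at this
      exact this.mono_left nhdsWithin_le_nhds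
    · filter_upwards [self_mem_nhdsWithin] with s hs h
      have := congrArg Complex.im h
      simp [hγ] at this
      exact absurd this (ne_of_lt hs)
  have hE : ContinuousAt (V.expErase ε lam m) (V.z m) := by
    refine (V.differentiableAt_expErase ε lam ⟨fun p hp h => hp ?_, by linarith⟩).continuousAt
    exact V.re_strictMono.injective h.symm
  have hlim1 : Tendsto (fun s => (-1) ^ n * k (γ s) * V.expErase ε lam m (γ s))
      (𝓝[<] (V.z m).im) (𝓝 ((-1) ^ n * k (V.z m) * V.expErase ε lam m (V.z m))) := by
    have := ((hk.continuousAt.tendsto.const_mul ((-1) ^ n)).mul hE.tendsto).mono_left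
      (nhdsWithin_le_nhds (s := {V.z m}ᶜ))
    exact this.comp hγt
  have h0 := congrFun hφ m
  rw [← V.integralC_integrand hε hlam S φ m, integralC, if_pos hexc] at h0
  simp only [integralEll, Pi.zero_apply] at h0
  have hlim2 : Tendsto (fun s => -(Complex.I / ε) * V.leftIntegral ε lam φ (γ s))
      (𝓝[<] (V.z m).im) (𝓝 0) := by
    have h1 : ContinuousOn (fun y => verticalSegment (V.integrand ε lam φ) (V.z m).re y)
        (Set.uIcc 0 (V.z m).im) := by
      refine intervalIntegral.continuousOn_primitive_interval ?_
      have := (V.intervalIntegrable_integrand_of_exceptional (lam := lam) hexc φ).mul_const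
        Complex.I
      rw [intervalIntegrable_iff'] at this
      exact this
    have h2 := h1 (V.z m).im Set.right_mem_uIcc
    have h3 : Tendsto (fun y => verticalSegment (V.integrand ε lam φ) (V.z m).re y)
        (𝓝[<] (V.z m).im) (𝓝 (verticalSegment (V.integrand ε lam φ) (V.z m).re (V.z m).im)) := by
      refine h2.tendsto.mono_left ?_
      rw [Set.uIcc_of_le him.le, nhdsWithin_Icc_eq_nhdsLE him]
      exact nhdsWithin_mono _ Set.Iio_subset_Iic_self
    have h4 := (h3.const_add (-rayIntegral (V.integrand ε lam φ) S.a +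
      (∫ t in S.a..(V.z m).re, V.integrand ε lam φ t))).const_mul (-(Complex.I / ε))
    have h5 : -rayIntegral (V.integrand ε lam φ) S.a +
      (∫ t in S.a..(V.z m).re, V.integrand ε lam φ t) +
      verticalSegment (V.integrand ε lam φ) (V.z m).re (V.z m).im = 0 := h0
    rw [h5, mul_zero] at h4
    refine h4.congr fun s => ?_
    rw [V.leftIntegral_eq hε hlam S]
    simp [hγ]
  have heq : ∀ᶠ s in 𝓝[<] (V.z m).im, (-1) ^ n * k (γ s) * V.expErase ε lam m (γ s) =
      -(Complex.I / ε) * V.leftIntegral ε lam φ (γ s) := by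
    have hnn : ∀ᶠ s in 𝓝[<] (V.z m).im, 0 < s :=
      mem_nhdsWithin_of_mem_nhds (lt_mem_nhds him)
    filter_upwards [hγt.eventually hky, hγt.eventually self_mem_nhdsWithin, hnn,
      self_mem_nhdsWithin] with s hs hne hs0 hsm
    have hG : γ s ∈ V.G := by
      intro q hq
      have : m = q := V.re_strictMono.injective (by simpa [hγ] using hq)
      subst this
      simpa [hγ, abs_of_pos hs0] using hsm
    have hpow : (V.z m - γ s) ^ n = (-1) ^ n * (γ s - V.z m) ^ n := by rw [← neg_sub, neg_pow]
    rw [← V.expNeg_mul_Phi, V.expNeg_eq_pow_mul hn hne, ← V.PhiUp_eq_Phi hε hlam S hφ hG, ← hs,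
      hpow]
    ring
  have := tendsto_nhds_unique (hlim1.congr' heq) hlim2
  exact mul_ne_zero (mul_ne_zero (pow_ne_zero _ (by norm_num)) hk0) (Complex.exp_ne_zero _) this

/-- The analytic continuation of `Phi` to a neighbourhood of the closed upper half-plane. -/
theorem exists_continuation (hε : 0 < ε) (hlam : lam < 0) (S : V.Abscissae)
    {φ : Fin P → ℂ} (hφ : (V.matrixA ε S lam).mulVec φ = 0) :
    ∃ Ψ : ℂ → ℂ, AnalyticOnNhd ℂ Ψ {x | 0 ≤ x.im} ∧
      (∀ x, (∀ p, x ≠ V.z p) → Ψ x = V.PhiUp ε lam φ x) := by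
  classical
  -- `PhiUp` takes arbitrary values at the poles themselves, so these are replaced by the limits
  -- there.
  set Ψ : ℂ → ℂ := fun x => if ∃ p, x = V.z p then limUnder (𝓝[≠] x) (V.PhiUp ε lam φ) else
    V.PhiUp ε lam φ x with hΨ
  have hΨeq : ∀ x, (∀ p, x ≠ V.z p) → Ψ x = V.PhiUp ε lam φ x := fun x hx =>
    if_neg (by simpa using hx)
  refine ⟨Ψ, fun x hx => ?_, hΨeq⟩
  have hne : ∀ᶠ y in 𝓝[≠] x, ∀ p, y ≠ V.z p := by
    rw [eventually_all]
    intro p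
    by_cases hp : x = V.z p
    · rw [← hp]; exact self_mem_nhdsWithin
    · exact mem_nhdsWithin_of_mem_nhds (isOpen_ne.mem_nhds hp)
  by_cases hp : ∃ p, x = V.z p
  · obtain ⟨m, rfl⟩ := hp
    obtain ⟨k, hk, hky⟩ := V.PhiUp_analytic hε hlam S hφ m
    refine hk.congr ?_
    rw [← nhdsNE_sup_pure, EventuallyEq, eventually_sup]
    constructor
    · filter_upwards [hky, hne] with y hy hy'
      rw [hΨeq y hy', hy]
    · have h1 : Tendsto (V.PhiUp ε lam φ) (𝓝[≠] (V.z m)) (𝓝 (k (V.z m))) :=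
        (hk.continuousAt.tendsto.mono_left nhdsWithin_le_nhds).congr' hky.symm
      simp only [eventually_pure]
      rw [hΨ]
      simp only [exists_apply_eq_apply', ↓reduceIte]
      exact h1.limUnder_eq.symm
  · have hp' : ∀ p, x ≠ V.z p := by simpa using hp
    have hopen : IsOpen (V.G ∪ V.upDomain) := V.isOpen_G.union V.isOpen_upDomain
    have hne' : ∀ᶠ y in 𝓝 x, ∀ p, y ≠ V.z p := by
      rw [eventually_all]
      exact fun p => isOpen_ne.mem_nhds (hp' p)
    have h1 : AnalyticAt ℂ (V.PhiUp ε lam φ) x := by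
      rw [Complex.analyticAt_iff_eventually_differentiableAt]
      filter_upwards [hopen.mem_nhds (V.mem_G_union_upDomain hx hp')] with y hy
      exact (V.hasDerivAt_PhiUp hε hlam S hφ hy).differentiableAt
    refine h1.congr ?_
    filter_upwards [hne'] with y hy
    exact (hΨeq y hy).symm

/-! ### Decay at infinity and integrals of the pole sum -/

theorem mem_upDomain_of_far {x : ℂ} (hx : 0 ≤ x.im) (hxf : V.farRadius ≤ ‖x‖) :
    x ∈ V.upDomain := by
  intro p hp
  by_contra hle
  have h1 := V.norm_z_le_farRadius p
  have h2 : ‖x‖ ≤ |x.re| + |x.im| := Complex.norm_le_abs_re_add_abs_im x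
  have h3 := Complex.abs_re_le_norm (V.z p)
  have h4 : |x.im| ≤ ‖V.z p‖ := by
    rw [abs_of_nonneg hx]
    exact (not_lt.1 hle).trans ((le_abs_self _).trans (Complex.abs_im_le_norm _))
  rw [hp] at h2
  linarith

theorem exists_norm_PhiUp_le (hε : 0 < ε) (hlam : lam < 0) (φ : Fin P → ℂ) :
    ∃ K : ℝ, 0 ≤ K ∧ ∀ x : ℂ, 0 ≤ x.im → V.farRadius ≤ ‖x‖ →
      ‖V.PhiUp ε lam φ x‖ ≤ K / ‖x‖ := by
  obtain ⟨K, hK⟩ := V.exists_norm_rayQuotient_le hε hlam φ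
  refine ⟨‖Complex.I / ε‖ * |K|, by positivity, fun x hx hxf => ?_⟩
  rw [V.PhiUp_eq_rayQuotient φ (V.mem_upDomain_of_far hx hxf), norm_mul, mul_div_assoc]
  gcongr
  refine (hK x hx hxf).trans ?_
  gcongr
  exact le_abs_self K

theorem sub_z_ne_zero_ofReal (x : ℝ) (p : Fin P) : (x : ℂ) - V.z p ≠ 0 :=
  V.sub_z_ne_zero_of_mem_G (V.ofReal_mem_G x) p

/-- The pole sum is only `O(1/x)`. Subtracting its leading term, placed at the lower point `-i`,
gives absolute integrability and lets each upper pole contribute `2πi`. -/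
theorem integral_poleSum_sub (φ : Fin P → ℂ) :
    Integrable (fun y : ℝ => V.poleSum φ y - (∑ p, φ p) / ((y : ℂ) + Complex.I)) ∧
      ∫ y : ℝ, V.poleSum φ y - (∑ p, φ p) / ((y : ℂ) + Complex.I) =
        2 * Real.pi * Complex.I * ∑ p, φ p := by
  have h1 : (fun y : ℝ => V.poleSum φ y - (∑ p, φ p) / ((y : ℂ) + Complex.I)) =
      fun y : ℝ => ∑ p, φ p * (((y : ℂ) - V.z p)⁻¹ - ((y : ℂ) + Complex.I)⁻¹) := by
    funext y
    rw [poleSum, Finset.sum_div, ← Finset.sum_sub_distrib]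
    exact Finset.sum_congr rfl fun p _ => by ring
  have h2 : ∀ p, Integrable fun y : ℝ =>
      φ p * (((y : ℂ) - V.z p)⁻¹ - ((y : ℂ) + Complex.I)⁻¹) := fun p =>
    (integral_inv_sub_inv_eq (V.im_pos p)).1.const_mul _
  rw [h1]
  refine ⟨integrable_finsetSum _ fun p _ => h2 p, ?_⟩
  rw [integral_finsetSum _ fun p _ => h2 p, Finset.mul_sum]
  refine Finset.sum_congr rfl fun p _ => ?_
  rw [integral_const_mul, (integral_inv_sub_inv_eq (V.im_pos p)).2]
  ring

/-- Every pole, including that of the Cauchy kernel, lies in the upper half-plane: this is why `C⁺`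
annihilates the pole sum. -/
theorem integral_poleSum_mul_inv (φ : Fin P → ℂ) {ζ : ℂ} (hζ : 0 < ζ.im) :
    Integrable (fun y : ℝ => V.poleSum φ y * ((y : ℂ) - ζ)⁻¹) ∧
      ∫ y : ℝ, V.poleSum φ y * ((y : ℂ) - ζ)⁻¹ = 0 := by
  have h1 : (fun y : ℝ => V.poleSum φ y * ((y : ℂ) - ζ)⁻¹) =
      fun y : ℝ => ∑ p, φ p * (((y : ℂ) - V.z p)⁻¹ * ((y : ℂ) - ζ)⁻¹) := by
    funext y
    rw [poleSum, Finset.sum_mul]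
    exact Finset.sum_congr rfl fun p _ => by ring
  have h2 : ∀ p, Integrable fun y : ℝ => φ p * (((y : ℂ) - V.z p)⁻¹ * ((y : ℂ) - ζ)⁻¹) := fun p =>
    (integral_inv_mul_inv_eq_zero (V.im_pos p) hζ).1.const_mul _
  rw [h1]
  refine ⟨integrable_finsetSum _ fun p _ => h2 p, ?_⟩
  rw [integral_finsetSum _ fun p _ => h2 p]
  refine Finset.sum_eq_zero fun p _ => ?_
  rw [integral_const_mul, (integral_inv_mul_inv_eq_zero (V.im_pos p) hζ).2, mul_zero]

/-- The difference of the pole sum and its leading term at infinity decays quadratically. -/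
theorem norm_poleSum_sub_le (φ : Fin P → ℂ) {x : ℂ}
    (hxf : max V.farRadius 2 ≤ ‖x‖) :
    ‖V.poleSum φ x - (∑ p, φ p) / (x + Complex.I)‖ ≤
      (∑ p, 4 * (‖φ p‖ * (‖V.z p‖ + 1))) / ‖x‖ ^ 2 := by
  simp only [max_le_iff] at hxf
  have hx0 : 0 < ‖x‖ := by linarith [hxf.2]
  have hI : ‖x‖ / 2 ≤ ‖x + Complex.I‖ := by
    have := norm_half_le_norm_sub (z := x) (w := -Complex.I) (by simpa using hxf.2)
    simpa using this
  have hI0 : x + Complex.I ≠ 0 := norm_pos_iff.1 (by linarith)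
  rw [poleSum, Finset.sum_div, ← Finset.sum_sub_distrib, Finset.sum_div]
  refine (norm_sum_le _ _).trans (Finset.sum_le_sum fun p _ => ?_)
  have h2 := V.far_sub hxf.1 p
  have h3 : x - V.z p ≠ 0 := norm_pos_iff.1 (by linarith [h2.1])
  have h4 : φ p / (x - V.z p) - φ p / (x + Complex.I) =
      φ p * (V.z p + Complex.I) / ((x - V.z p) * (x + Complex.I)) := by
    field_simp
    ring
  rw [h4, norm_div, norm_mul, norm_mul]
  calc ‖φ p‖ * ‖V.z p + Complex.I‖ / (‖x - V.z p‖ * ‖x + Complex.I‖)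
      ≤ ‖φ p‖ * (‖V.z p‖ + 1) / ((‖x‖ / 2) * (‖x‖ / 2)) := by
        gcongr
        · refine (norm_add_le _ _).trans ?_
          simp
        · exact h2.2
    _ = _ := by field_simp; norm_num

/-- A function on the closed upper half-plane that is continuous and `O(1/x)` is square integrable
uniformly on horizontal lines. -/
theorem exists_sq_bound {Ψ : ℂ → ℂ} (hΨ : ContinuousOn Ψ {x | 0 ≤ x.im}) {K R : ℝ} (hR : 1 ≤ R)
    (hb : ∀ x : ℂ, 0 ≤ x.im → R ≤ ‖x‖ → ‖Ψ x‖ ≤ K / ‖x‖) :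
    ∃ C : ℝ, ∀ x : ℂ, 0 ≤ x.im → ‖Ψ x‖ ^ 2 ≤ C * (1 + x.re ^ 2)⁻¹ := by
  have hcomp : IsCompact (Metric.closedBall (0 : ℂ) R ∩ {x | 0 ≤ x.im}) :=
    (isCompact_closedBall 0 R).inter_right (isClosed_le continuous_const Complex.continuous_im)
  obtain ⟨M, hM⟩ := hcomp.exists_bound_of_continuousOn (hΨ.mono Set.inter_subset_right)
  refine ⟨M ^ 2 * (1 + R ^ 2) + 2 * K ^ 2, fun x hx => ?_⟩
  rw [← div_eq_mul_inv, le_div_iff₀ (by positivity)]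
  have hre : x.re ^ 2 ≤ ‖x‖ ^ 2 := by
    rw [← sq_abs x.re]
    exact pow_le_pow_left₀ (abs_nonneg _) (Complex.abs_re_le_norm x) 2
  rcases le_total ‖x‖ R with h | h
  · have h1 := hM x ⟨by simpa using h, hx⟩
    have h2 : ‖x‖ ^ 2 ≤ R ^ 2 := by gcongr
    calc ‖Ψ x‖ ^ 2 * (1 + x.re ^ 2) ≤ M ^ 2 * (1 + R ^ 2) :=
          mul_le_mul (by gcongr) (by linarith) (by positivity) (by positivity)
      _ ≤ _ := by nlinarith [sq_nonneg K]
  · have h1 := hb x hx h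
    have hx1 : 1 ≤ ‖x‖ := hR.trans h
    have hx2 : 1 ≤ ‖x‖ ^ 2 := one_le_pow₀ hx1
    calc ‖Ψ x‖ ^ 2 * (1 + x.re ^ 2) ≤ (K / ‖x‖) ^ 2 * (2 * ‖x‖ ^ 2) :=
          mul_le_mul (by gcongr) (by linarith) (by positivity) (by positivity)
      _ = 2 * K ^ 2 := by field_simp
      _ ≤ _ := by have : 0 ≤ M ^ 2 * (1 + R ^ 2) := by positivity
                  linarith

end RationalPotential

end

/-! ### The theorem -/

theorem corollary3p4 {P : ℕ} (V : RationalPotential P) (S : V.Abscissae) (ε : ℝ) (hε : 0 < ε)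
    (lam : ℝ) (hlam : lam < 0) (hD : V.evansD ε S lam = 0)
    (φ : Fin P → ℂ) (hφ : (V.matrixA ε S lam).mulVec φ = 0) (hsum : ∑ p, φ p = (lam : ℂ)) :
    -- the improper integral that defines `Φ` converges
    (∀ x : ℝ, ∃ l : ℂ,
      Tendsto (fun R : ℝ => ∫ t in (-R)..x, V.integrand ε lam φ t) atTop (𝓝 l)) ∧
    -- the normalization condition
    Integrable (fun x : ℝ => V.u₀ x * V.Phi ε lam φ x) ∧
    1 / (2 * Real.pi * Complex.I) * ∫ x : ℝ, V.u₀ x * V.Phi ε lam φ x = lam ∧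
    -- `Φ` belongs to the Hardy space, through its own analytic continuation to the closed upper
    -- half-plane, which vanishes at infinity
    (∃ Ψ : ℂ → ℂ,
      AnalyticOnNhd ℂ Ψ {x | 0 ≤ x.im} ∧
      (∀ x ∈ V.G, 0 ≤ x.im → Ψ x = V.Phi ε lam φ x) ∧
      Tendsto Ψ (Bornology.cobounded ℂ ⊓ 𝓟 {x | 0 ≤ x.im}) (𝓝 0) ∧
      IsHardyExtension Ψ (fun x : ℝ => V.Phi ε lam φ x)) ∧
    -- `Φ` is an eigenfunction
    IsBoundState ε lam V.u₀ (fun x : ℝ => V.Phi ε lam φ x) := by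
  have hε' : (ε : ℂ) ≠ 0 := Complex.ofReal_ne_zero.2 hε.ne'
  have h2pi : (2 * Real.pi * Complex.I : ℂ) ≠ 0 := Complex.two_pi_I_ne_zero
  obtain ⟨Ψ, hΨa, hΨeq⟩ := V.exists_continuation hε hlam S hφ
  obtain ⟨M, hM0, hM⟩ := V.exists_norm_PhiUp_le hε hlam φ
  obtain ⟨Cu, hCu0, hCu⟩ := V.exists_norm_u₀Ext_le
  have hfar1 := V.one_le_farRadius
  have hfarne : ∀ x : ℂ, V.farRadius ≤ ‖x‖ → ∀ p, x ≠ V.z p := fun x hx p h => by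
    have := (V.far_sub hx p).1
    rw [h, sub_self, norm_zero] at this
    linarith
  have hΨM : ∀ x : ℂ, 0 ≤ x.im → V.farRadius ≤ ‖x‖ → ‖Ψ x‖ ≤ M / ‖x‖ := fun x hx hxf => by
    rw [hΨeq x (hfarne x hxf)]
    exact hM x hx hxf
  have hΨG : ∀ x ∈ V.G, Ψ x = V.Phi ε lam φ x := fun x hx => by
    rw [hΨeq x fun p => sub_ne_zero.1 (V.sub_z_ne_zero_of_mem_G hx p),
      V.PhiUp_eq_Phi hε hlam S hφ hx]
  have hΨR : ∀ x : ℝ, V.Phi ε lam φ x = Ψ x := fun x => (hΨG x (V.ofReal_mem_G x)).symm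
  have hfun : (fun x : ℝ => V.Phi ε lam φ x) = fun x : ℝ => Ψ x := funext hΨR
  -- Away from the poles `K = u₀Ψ - q`. The form with the derivative shows analyticity at the poles
  -- too, where both terms of the difference may be singular.
  set K : ℂ → ℂ := fun x => -(Complex.I * ε) * deriv Ψ x - lam * Ψ x with hK
  have hKa : AnalyticOnNhd ℂ K {x | 0 ≤ x.im} := fun x hx =>
    (analyticAt_const.mul (hΨa x hx).deriv).sub (analyticAt_const.mul (hΨa x hx))
  have hKeq : ∀ x : ℂ, 0 ≤ x.im → (∀ p, x ≠ V.z p) →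
      K x = V.u₀Ext x * Ψ x - V.poleSum φ x := by
    intro x hx hxz
    have hne : ∀ᶠ y in 𝓝 x, ∀ p, y ≠ V.z p := by
      rw [eventually_all]
      exact fun p => isOpen_ne.mem_nhds (hxz p)
    have h1 : HasDerivAt Ψ _ x := (V.hasDerivAt_PhiUp hε hlam S hφ
      (V.mem_G_union_upDomain hx hxz)).congr_of_eventuallyEq
        (by filter_upwards [hne] with y hy; exact hΨeq y hy)
    simp only [hK]
    rw [h1.deriv, hΨeq x hxz]
    field_simp
    linear_combination (-(lam + V.u₀Ext x) * V.PhiUp ε lam φ x + V.poleSum φ x) * Complex.I_sq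
  have hUΨ : ∀ x : ℂ, 0 ≤ x.im → V.farRadius ≤ ‖x‖ →
      ‖V.u₀Ext x * Ψ x‖ ≤ Cu * M / ‖x‖ ^ 2 := by
    intro x hx hxf
    have hx1 : 1 ≤ ‖x‖ := hfar1.trans hxf
    rw [norm_mul]
    calc _ ≤ Cu / ‖x‖ ^ 2 * (M / ‖x‖) := by
          gcongr
          · exact hCu x hxf
          · exact hΨM x hx hxf
      _ ≤ Cu / ‖x‖ ^ 2 * M := by gcongr; exact div_le_self hM0 hx1
      _ = _ := by ring
  have hKb : ∀ x : ℂ, 0 ≤ x.im → V.farRadius ≤ ‖x‖ →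
      ‖K x‖ ≤ (Cu * M + 2 * ∑ p, ‖φ p‖) / ‖x‖ := by
    intro x hx hxf
    have hx1 : 1 ≤ ‖x‖ := hfar1.trans hxf
    rw [hKeq x hx (hfarne x hxf), add_div]
    refine (norm_sub_le _ _).trans (add_le_add ((hUΨ x hx hxf).trans ?_) (V.norm_poleSum_le φ hxf))
    gcongr
    exact le_self_pow₀ hx1 two_ne_zero
  have hu₀ : ∀ y : ℝ, V.u₀ y * V.Phi ε lam φ y = K y + V.poleSum φ y := by
    intro y
    rw [hKeq y (by simp) (fun p => sub_ne_zero.1 (V.sub_z_ne_zero_ofReal y p)), hΨR,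
      RationalPotential.u₀Ext_ofReal]
    ring
  have hI : ∀ z : ℂ, 0 ≤ z.im → z + Complex.I ≠ 0 := by
    intro z hz h
    have := congrArg Complex.im h
    simp at this; linarith
  have hK₀d : ∀ x : ℂ, 0 ≤ x.im →
      DifferentiableAt ℂ (fun x => K x + lam / (x + Complex.I)) x := fun x hx =>
    (hKa x hx).differentiableAt.add ((differentiableAt_const _).div (by fun_prop) (hI x hx))
  -- Because `∑ φ p = lam`, the leading term `-lam/x` of `K` cancels against `lam / (x + i)`, and
  -- the sum is `O(1/x²)`, so Cauchy's theorem applies.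
  obtain ⟨hK₀i, hK₀⟩ := integral_eq_zero_of_upperHalfPlane
    (F := fun x => K x + lam / (x + Complex.I)) (R := max V.farRadius 2)
    (C := Cu * M + ∑ p, 4 * (‖φ p‖ * (‖V.z p‖ + 1)))
    (fun x hx => (hK₀d x hx).continuousAt.continuousWithinAt)
    (fun x hx => (hK₀d x (le_of_lt hx)).differentiableWithinAt) (by
      intro x hx hxf
      have hxf' := (le_max_left _ _).trans hxf
      have h1 : K x + lam / (x + Complex.I) =
          V.u₀Ext x * Ψ x - (V.poleSum φ x - (∑ p, φ p) / (x + Complex.I)) := by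
        rw [hKeq x hx (hfarne x hxf'), hsum]
        ring
      rw [h1, add_div]
      exact (norm_sub_le _ _).trans (add_le_add (hUΨ x hx hxf') (V.norm_poleSum_sub_le φ hxf)))
  obtain ⟨hqi, hq⟩ := V.integral_poleSum_sub φ
  have hsplit : (fun y : ℝ => V.u₀ y * V.Phi ε lam φ y) = fun y : ℝ =>
      (K y + lam / (y + Complex.I)) + (V.poleSum φ y - (∑ p, φ p) / ((y : ℂ) + Complex.I)) := by
    funext y
    rw [hu₀, hsum]
    ring
  have hint : Integrable (fun x : ℝ => V.u₀ x * V.Phi ε lam φ x) := by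
    rw [hsplit]
    exact hK₀i.add hqi
  have hnorm : 1 / (2 * Real.pi * Complex.I) * ∫ x : ℝ, V.u₀ x * V.Phi ε lam φ x = lam := by
    rw [hsplit, integral_add hK₀i hqi, hK₀, hq, hsum]
    field_simp
    ring
  obtain ⟨C, hC⟩ := RationalPotential.exists_sq_bound hΨa.continuousOn hfar1 hΨM
  have hHardy : IsHardyExtension Ψ (fun x : ℝ => V.Phi ε lam φ x) := by
    rw [hfun]
    exact isHardyExtension_of_norm_le hΨa hC
  refine ⟨fun x => ⟨_, V.tendsto_integral_integrand hε hlam φ S x⟩, hint, hnorm,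
    ⟨Ψ, hΨa, fun x hx _ => hΨG x hx, ?_, hHardy⟩, ⟨Ψ, hHardy⟩, ?_, ?_, fun x => ⟨K x, ⟨?_, ?_⟩, ?_⟩⟩
  · have h0 : Tendsto (fun x : ℂ => M / ‖x‖) (Bornology.cobounded ℂ ⊓ 𝓟 {x | 0 ≤ x.im}) (𝓝 0) :=
      (tendsto_const_nhds.div_atTop tendsto_norm_cobounded_atTop).mono_left inf_le_left
    refine squeeze_zero_norm' ?_ h0
    filter_upwards [mem_inf_of_left (tendsto_norm_cobounded_atTop.eventually_ge_atTop V.farRadius),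
      mem_inf_of_right (mem_principal_self _)] with x hx hx'
    exact hΨM x hx' hx
  -- A vanishing `Phi` would make the normalization integral zero instead of `lam < 0`.
  · intro hw
    have h1 : ∀ x : ℝ, V.Phi ε lam φ x = 0 := fun x => congrFun hw x
    simp only [h1, mul_zero, integral_zero] at hnorm
    exact hlam.ne (by exact_mod_cast hnorm.symm)
  · rw [hfun]
    exact fun x => ((hΨa x (by simp)).differentiableAt.hasDerivAt.comp_ofReal).differentiableAt
  all_goals
    -- Cauchy's formula reproduces `K` at `x + iδ` and the pole sum drops out; continuity of `K` up
    -- to the real line then gives the limit as `δ` decreases to zero.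
    have hcauchy : ∀ δ : ℝ, 0 < δ →
        Integrable (fun y : ℝ => V.u₀ y * V.Phi ε lam φ y / (y - (x + δ * Complex.I))) ∧
        ∫ y : ℝ, V.u₀ y * V.Phi ε lam φ y / (y - (x + δ * Complex.I)) =
          2 * Real.pi * Complex.I * K (x + δ * Complex.I) := by
      intro δ hδ
      have hζ : 0 < (x + δ * Complex.I : ℂ).im := by simpa using hδ
      obtain ⟨h1, h2⟩ := integral_div_sub_of_upperHalfPlane hKa hKb hζ
      obtain ⟨h3, h4⟩ := V.integral_poleSum_mul_inv φ hζ
      have h5 : (fun y : ℝ => V.u₀ y * V.Phi ε lam φ y / (y - (x + δ * Complex.I))) =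
          fun y : ℝ => K y * ((y : ℂ) - (x + δ * Complex.I))⁻¹ +
            V.poleSum φ y * ((y : ℂ) - (x + δ * Complex.I))⁻¹ := by
        funext y
        rw [hu₀]
        ring
      rw [h5]
      refine ⟨h1.add h3, ?_⟩
      rw [integral_add h1 h3, h2, h4, add_zero]
  · exact fun δ hδ => (hcauchy δ hδ).1
  · have h1 : ContinuousAt (fun δ : ℝ => K (x + δ * Complex.I)) 0 := by
      have : ContinuousAt K (x + (0 : ℝ) * Complex.I) := (hKa _ (by simp)).continuousAt
      exact ContinuousAt.comp (f := fun δ : ℝ => (x + δ * Complex.I : ℂ)) this (by fun_prop)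
    have h2 := h1.tendsto.mono_left (nhdsWithin_le_nhds (s := Set.Ioi 0))
    simp only [Complex.ofReal_zero, zero_mul, add_zero] at h2
    refine h2.congr' ?_
    filter_upwards [self_mem_nhdsWithin] with δ hδ
    rw [(hcauchy δ hδ).2]
    field_simp
  · have h1 := (hΨa x (by simp)).differentiableAt.hasDerivAt.comp_ofReal
    rw [hfun, h1.deriv]
    simp only [hK]
    ring
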